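/- Let $q$ be a complex number with $|q|<1$. For an integer $n\ge 0$ put $(q;q)_n=\prod_{k=1}^{n}(1-q^k)$, and for integers $A,m$ put $$\begin{bmatrix}A\\ m\end{bmatrix}_q=\frac{(q;q)_A}{(q;q)_m\,(q;q)_{A-m}}\ \text{ if } m\ge 0 \text{ and } A-m\ge 0,\qquad \begin{bmatrix}A\\ m\end{bmatrix}_q=0\ \text{ otherwise.}$$ For integers $L,M,a,b$ define the refined $q$-trinomial coefficient $$\mathcal S\!\left(\begin{matrix}L,\,M\\ a,\,b\end{matrix};q\right)=\sum_{n\ge 0}q^{n(n+a)}\begin{bmatrix}M+L-a-2n\\ M\end{bmatrix}_q\begin{bmatrix}M-a+b\\ n\end{bmatrix}_q\begin{bmatrix}M+a-b\\ n+a\end{bmatrix}_q .$$ **Theorem.** Let $\nu$ be a positive integer, let $L,M$ be non-negative integers, and write $N_k=n_k+n_{k+1}+\dots+n_\nu$ for $k=1,\dots,\nu$. Then $$\sum_{\substack{i,m,n_1,\dots,n_\nu\ge 0\\ i+m\equiv N_1+\dots+N_\nu\ (\mathrm{mod}\ 2)}} q^{\frac{m^2+3(i^2+N_1^2+\dots+N_\nu^2)}{2}}\begin{bmatrix}L+M-i\\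 L\end{bmatrix}_{q^3}\begin{bmatrix}L-N_1\\ i\end{bmatrix}_{q^3}\begin{bmatrix}3n_\nu\\ m\end{bmatrix}_{q}\begin{bmatrix}2n_\nu+\frac{i-m-N_1-\dots-N_\nu}{2}\\ 2n_\nu\end{bmatrix}_{q^3}\prod_{j=1}^{\nu-1}\begin{bmatrix}i-\sum_{l=1}^{j}N_l+n_j\\ n_j\end{bmatrix}_{q^3}$$ $$=\sum_{j=-\infty}^{\infty}q^{3\binom{\nu+2}{2}j^2+j}\,\mathcal S\!\left(\begin{matrix}L,\,M\\ (\nu+2)j,\,(\nu+1)j\end{matrix};q^3\right),$$ where only finitely many terms are nonzero on either side. -/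

import Mathlib

noncomputable section

namespace RefinedTrinomial

/-- The `q`-shifted factorial `(a; q)_n = (1 - a) (1 - a q) ⋯ (1 - a q ^ (n - 1))`, for `n ≥ 0`. -/
def qPoch (a q : ℂ) (n : ℕ) : ℂ :=
  ∏ k ∈ Finset.range n, (1 - a * q ^ k)

/-- The `q`-binomial coefficient with integer entries `A` (top) and `m` (bottom):
`(q; q)_A / ((q; q)_m (q; q)_(A - m))` if `m ≥ 0` and `A - m ≥ 0`, and `0` otherwise. -/
def qBinom (q : ℂ) (A m : ℤ) : ℂ :=
  if 0 ≤ m ∧ 0 ≤ A - m then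
    qPoch q q A.toNat / (qPoch q q m.toNat * qPoch q q (A - m).toNat)
  else 0

/-- The summand of the refined `q`-trinomial coefficient `𝒮(L, M; a, b; q)`. -/
def refinedSTerm (L M a b : ℤ) (q : ℂ) (n : ℕ) : ℂ :=
  q ^ ((n : ℤ) * (n + a)) * qBinom q (M + L - a - 2 * n) M * qBinom q (M - a + b) n *
    qBinom q (M + a - b) (n + a)

/-- Only finitely many summands of `𝒮(L, M; a, b; q)` are nonzero. -/
theorem refinedSTerm_support_finite (L M a b : ℤ) (q : ℂ) :
    (Function.support (refinedSTerm L M a b q)).Finite := by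
  refine (Set.finite_Iic (M - a + b).toNat).subset fun n hn => ?_
  by_contra h
  refine hn ?_
  have hz : qBinom q (M - a + b) n = 0 := by
    unfold qBinom
    rw [if_neg]
    simp only [Set.mem_Iic] at h
    omega
  simp [refinedSTerm, hz]

/-- The refined `q`-trinomial coefficient `𝒮(L, M; a, b; q)`
(a sum over `n ≥ 0` with finitely many nonzero terms). -/
def refinedS (L M a b : ℤ) (q : ℂ) : ℂ :=
  ∑ᶠ n : ℕ, refinedSTerm L M a b q n

/-- The entries of the tuple `(n_1, …, n_ν)`, indexed from `1` (with value `0` outside `1, …, ν`). -/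
def entry {ν : ℕ} (n : Fin ν → ℕ) (k : ℕ) : ℕ :=
  if h : 1 ≤ k ∧ k ≤ ν then n ⟨k - 1, by omega⟩ else 0

/-- `N_k = n_k + n_(k+1) + ⋯ + n_ν`. -/
def tail {ν : ℕ} (n : Fin ν → ℕ) (k : ℕ) : ℕ :=
  ∑ l ∈ Finset.Icc k ν, entry n l

/-- The term of the multisum with indices `i, m, n_1, …, n_ν`; it is `0` unless
`i + m ≡ N_1 + ⋯ + N_ν (mod 2)`. Under that congruence both divisions by `2` are exact. -/
def multisumTerm (ν L M : ℕ) (q : ℂ) (x : ℕ × ℕ × (Fin ν → ℕ)) : ℂ :=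
  let i := x.1
  let m := x.2.1
  let n := x.2.2
  if i + m ≡ ∑ k ∈ Finset.Icc 1 ν, tail n k [MOD 2] then
    q ^ ((m ^ 2 + 3 * (i ^ 2 + ∑ k ∈ Finset.Icc 1 ν, tail n k ^ 2)) / 2) *
      qBinom (q ^ 3) ((L : ℤ) + M - i) L *
      qBinom (q ^ 3) ((L : ℤ) - tail n 1) i *
      qBinom q (3 * entry n ν) m *
      qBinom (q ^ 3)
        (2 * entry n ν + ((i : ℤ) - m - ∑ k ∈ Finset.Icc 1 ν, (tail n k : ℤ)) / 2)
        (2 * entry n ν) *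
      ∏ j ∈ Finset.Icc 1 (ν - 1),
        qBinom (q ^ 3) ((i : ℤ) - (∑ l ∈ Finset.Icc 1 j, (tail n l : ℤ)) + entry n j) (entry n j)
  else 0

/-- The term with index `j` of the bilateral sum:
`q ^ (3 * C(ν + 2, 2) * j ^ 2 + j) * 𝒮(L, M; (ν + 2) j, (ν + 1) j; q ^ 3)`. -/
def bilateralTerm (ν L M : ℕ) (q : ℂ) (j : ℤ) : ℂ :=
  q ^ (3 * ((ν + 2).choose 2 : ℤ) * j ^ 2 + j) *
    refinedS L M ((ν + 2) * j) ((ν + 1) * j) (q ^ 3)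

end RefinedTrinomial

end

/-! Put q = r² and s = r³, so that the base q³ is s² and half-integer powers of q are powers of r.
For |b| ≤ M the companion coefficient 𝒯(k, M; a, b) (`refinedT`) is the coefficient of x^k z^a in
(-sx; s²)_M / ((x/z; s²)_(M+b+1) (xz; s²)_(M-b+1)). Three facts carry the proof.

Seed (`finsum_seedTerm`): the q-Pfaff–Saalschütz sum turns s^(j²) 𝒯(k, n; j, j) into the coefficient
of x^k z^j in (-sx/z; s²)_n (-sx; s²)_n (-sxz; s²)_n / (x²; s²)_(2n+1). At z = q the numerator
becomes (-x q^(1/2); q)_(3n), which produces the base-q coefficient [3n, m] next to one in base q³.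

Transformations: summing 𝒯 against s^(i²) and a Gaussian coefficient gives 𝒯 again, with a replaced
by a + b (`sum_gauss_mul_refinedT`), or gives 𝒮 (`sum_gauss_mul_refinedT_eq_refinedS`). For fixed L,
the sums over i are coefficients of a product of power series in X, where X marks M and the kernel
is 1/(X; s²)_(L+1). For b = 0 both sides satisfy one recurrence in L; larger b is reached by
relations that raise b.

Iteration: ν applications of the first transformation to the seed give the sums over n_1, …, n_ν,
and one application of the second gives the sum over i. Negative j is covered by the symmetry (a, b)
↦ (-a, -b). As powers of r are inverted throughout, q = 0 is checked directly. -/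

noncomputable section

namespace RefinedTrinomial

open PowerSeries (X C mk coeff rescale coeff_mk coeff_zero_X_mul coeff_succ_X_mul coeff_rescale
  coeff_C_mul coeff_mul coeff_C coeff_mul_C rescale_X)

variable {r s : ℂ}

/-! ### Gaussian binomial coefficients -/

theorem qPoch_zero (a q : ℂ) : qPoch a q 0 = 1 := by simp [qPoch]

theorem qPoch_self_succ (q : ℂ) (n : ℕ) :
    qPoch q q (n + 1) = qPoch q q n * (1 - q ^ (n + 1)) := by
  rw [qPoch, Finset.prod_range_succ, ← qPoch, pow_succ']

/-- `p` is not zero, and no positive power of it is `1`. -/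
structure Generic (p : ℂ) : Prop where
  ne_zero : p ≠ 0
  pow_ne_one : ∀ n : ℕ, p ^ (n + 1) ≠ 1

theorem generic_of_norm_lt_one {p : ℂ} (h0 : p ≠ 0) (h1 : ‖p‖ < 1) : Generic p :=
  ⟨h0, fun n h => by
    have h2 : ‖p‖ ^ (n + 1) < 1 := pow_lt_one₀ (norm_nonneg _) h1 (Nat.succ_ne_zero n)
    rw [← norm_pow, h, norm_one] at h2
    exact lt_irrefl _ h2⟩

theorem Generic.qPoch_ne_zero {p : ℂ} (hp : Generic p) (n : ℕ) : qPoch p p n ≠ 0 := by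
  induction n with
  | zero => simp [qPoch_zero]
  | succ n ih =>
    rw [qPoch_self_succ]
    exact mul_ne_zero ih (sub_ne_zero.2 (hp.pow_ne_one n).symm)

/-- The Gaussian binomial coefficient with top entry `P + A` and bottom entry `A`. -/
def gauss (p : ℂ) (P A : ℤ) : ℂ := qBinom p (P + A) A

theorem qBinom_eq_gauss (p : ℂ) (A m : ℤ) : qBinom p A m = gauss p (A - m) m := by
  rw [gauss, sub_add_cancel]

theorem gauss_natCast (p : ℂ) (P A : ℕ) :
    gauss p P A = qPoch p p (P + A) / (qPoch p p A * qPoch p p P) := by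
  have h : ((P : ℤ) + A).toNat = P + A := by omega
  simp [gauss, qBinom, h]

theorem gauss_of_left_neg {p : ℂ} {P : ℤ} (h : P < 0) (A : ℤ) : gauss p P A = 0 := by
  rw [gauss, qBinom, if_neg (by omega)]

theorem gauss_of_right_neg {p : ℂ} {A : ℤ} (P : ℤ) (h : A < 0) : gauss p P A = 0 := by
  rw [gauss, qBinom, if_neg (by omega)]

theorem gauss_symm (p : ℂ) (P A : ℤ) : gauss p P A = gauss p A P := by
  rcases lt_or_ge P 0 with h | h
  · rw [gauss_of_left_neg h, gauss_of_right_neg _ h]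
  rcases lt_or_ge A 0 with h' | h'
  · rw [gauss_of_left_neg h', gauss_of_right_neg _ h']
  lift P to ℕ using h
  lift A to ℕ using h'
  rw [gauss_natCast, gauss_natCast, add_comm, mul_comm]

theorem qBinom_symm (p : ℂ) (A m : ℤ) : qBinom p A m = qBinom p A (A - m) := by
  rw [qBinom_eq_gauss, qBinom_eq_gauss, gauss_symm, sub_sub_cancel]

theorem gauss_zero_right {p : ℂ} (hp : Generic p) {P : ℤ} (h : 0 ≤ P) : gauss p P 0 = 1 := by
  lift P to ℕ using h
  have h2 := gauss_natCast p P 0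
  rw [Nat.cast_zero] at h2
  rw [h2, qPoch_zero, one_mul, add_zero, div_self (hp.qPoch_ne_zero P)]

theorem gauss_zero_left {p : ℂ} (hp : Generic p) {A : ℤ} (h : 0 ≤ A) : gauss p 0 A = 1 := by
  rw [gauss_symm, gauss_zero_right hp h]

/-- At `P = A = 0` the left side is 1 and the right side 0, since coefficients with a negative entry
are set to 0. This is the only exception. -/
theorem gauss_pascal {p : ℂ} (hp : Generic p) {P A : ℤ} (h : P ≠ 0 ∨ A ≠ 0) :
    gauss p P A = gauss p (P - 1) A + p ^ P * gauss p P (A - 1) := by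
  rcases lt_or_ge P 0 with hP | hP
  · rw [gauss_of_left_neg hP, gauss_of_left_neg (by omega), gauss_of_left_neg hP]; simp
  rcases lt_or_ge A 0 with hA | hA
  · rw [gauss_of_right_neg _ hA, gauss_of_right_neg _ hA, gauss_of_right_neg _ (by omega)]; simp
  rcases hP.eq_or_lt with rfl | hP
  · have hA' : 0 ≤ A - 1 := by omega
    rw [gauss_zero_left hp hA, gauss_zero_left hp hA', gauss_of_left_neg (by omega)]; simp
  rcases hA.eq_or_lt with rfl | hA
  · rw [gauss_zero_right hp hP.le, gauss_zero_right hp (by omega),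
      gauss_of_right_neg _ (by omega)]; simp
  obtain ⟨P, rfl⟩ : ∃ n : ℕ, P = (n + 1 : ℕ) := ⟨(P - 1).toNat, by omega⟩
  obtain ⟨A, rfl⟩ : ∃ n : ℕ, A = (n + 1 : ℕ) := ⟨(A - 1).toNat, by omega⟩
  have e1 : ((P + 1 : ℕ) : ℤ) - 1 = (P : ℕ) := by push_cast; ring
  have e2 : ((A + 1 : ℕ) : ℤ) - 1 = (A : ℕ) := by push_cast; ring
  rw [e1, e2, gauss_natCast, gauss_natCast, gauss_natCast, zpow_natCast]
  have e3 : P + 1 + (A + 1) = P + A + 1 + 1 := by ring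
  have e4 : P + (A + 1) = P + A + 1 := by ring
  have e5 : P + 1 + A = P + A + 1 := by ring
  rw [e3, e4, e5]
  simp only [qPoch_self_succ]
  have n1 := hp.qPoch_ne_zero P
  have n2 := hp.qPoch_ne_zero A
  have n3 : (1 - p ^ (P + 1)) ≠ 0 := sub_ne_zero.2 (hp.pow_ne_one P).symm
  have n4 : (1 - p ^ (A + 1)) ≠ 0 := sub_ne_zero.2 (hp.pow_ne_one A).symm
  field_simp
  ring

theorem gauss_pascal' {p : ℂ} (hp : Generic p) {P A : ℤ} (h : P ≠ 0 ∨ A ≠ 0) :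
    gauss p P A = p ^ A * gauss p (P - 1) A + gauss p P (A - 1) := by
  rw [gauss_symm, gauss_pascal hp h.symm, gauss_symm p (A - 1), gauss_symm p A (P - 1), add_comm]

/-! ### Three-fold convolutions -/

/-- A function on the integers that is zero at the negative integers. -/
def VanishesNeg (f : ℤ → ℂ) : Prop := ∀ n < 0, f n = 0

theorem finsum_add_const_mul {ι : Type*} {f g : ι → ℂ} (hf : (Function.support f).Finite)
    (hg : (Function.support g).Finite) (c : ℂ) :
    ∑ᶠ i, (f i + c * g i) = ∑ᶠ i, f i + c * ∑ᶠ i, g i := by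
  rw [mul_finsum]
  exact finsum_add_distrib hf (hg.subset (Function.support_const_smul_subset c g))

/-- The coefficient of `x ^ k z ^ a` in the product of the generating functions
`∑ e n x ^ n`, `∑ f n (x / z) ^ n` and `∑ g n (x z) ^ n`. -/
def tripleConv (e f g : ℤ → ℂ) (k a : ℤ) : ℂ := ∑ᶠ A : ℤ, e (k - 2 * A - a) * f A * g (A + a)

theorem tripleConv_support {e f : ℤ → ℂ} (he : VanishesNeg e) (hf : VanishesNeg f) (g : ℤ → ℂ)
    (k a : ℤ) : Function.support (fun A : ℤ => e (k - 2 * A - a) * f A * g (A + a)) ⊆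
      (Finset.Icc 0 (k - a) : Finset ℤ) := by
  intro A hA
  have h1 : ¬ A < 0 := fun h => hA (by simp [hf A h])
  have h2 : ¬ k - 2 * A - a < 0 := fun h => hA (by simp [he _ h])
  rw [Finset.coe_Icc]
  exact ⟨by omega, by omega⟩

theorem tripleConv_finite {e f : ℤ → ℂ} (he : VanishesNeg e) (hf : VanishesNeg f) (g : ℤ → ℂ)
    (k a : ℤ) : (Function.support (fun A : ℤ => e (k - 2 * A - a) * f A * g (A + a))).Finite :=
  (Finset.finite_toSet _).subset (tripleConv_support he hf g k a)

/-- Linearity: the shifted term carries a factor x, which lowers `k`. In the second and third slots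
the factor is x/z or xz, which moves `a` as well. -/
theorem tripleConv_left {e e₁ e₂ f : ℤ → ℂ} {c : ℂ} (h₁ : VanishesNeg e₁) (h₂ : VanishesNeg e₂)
    (hf : VanishesNeg f) (h : ∀ n, e n = e₁ n + c * e₂ (n - 1)) (g : ℤ → ℂ) (k a : ℤ) :
    tripleConv e f g k a = tripleConv e₁ f g k a + c * tripleConv e₂ f g (k - 1) a := by
  unfold tripleConv
  rw [← finsum_add_const_mul (tripleConv_finite h₁ hf g k a)
    (tripleConv_finite h₂ hf g (k - 1) a)]
  refine finsum_congr fun A => ?_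
  rw [h, show k - 2 * A - a - 1 = k - 1 - 2 * A - a by ring]
  ring

theorem tripleConv_mid {e f f₁ f₂ : ℤ → ℂ} {c : ℂ} (he : VanishesNeg e) (h₁ : VanishesNeg f₁)
    (h₂ : VanishesNeg f₂) (h : ∀ n, f n = f₁ n + c * f₂ (n - 1)) (g : ℤ → ℂ) (k a : ℤ) :
    tripleConv e f g k a = tripleConv e f₁ g k a + c * tripleConv e f₂ g (k - 1) (a + 1) := by
  unfold tripleConv
  rw [← finsum_comp_equiv (Equiv.subRight (1 : ℤ))
    (f := fun A => e (k - 1 - 2 * A - (a + 1)) * f₂ A * g (A + (a + 1))),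
    ← finsum_add_const_mul (tripleConv_finite he h₁ g k a)
      ((tripleConv_finite he h₂ g (k - 1) (a + 1)).preimage
        (Equiv.subRight (1 : ℤ)).injective.injOn)]
  refine finsum_congr fun A => ?_
  simp only [Equiv.subRight_apply]
  rw [h, show k - 1 - 2 * (A - 1) - (a + 1) = k - 2 * A - a by ring,
    show A - 1 + (a + 1) = A + a by ring]
  ring

/-- As `f` vanishes at negative `A`, only values of `g` at `A + a ≥ a` enter. Asking for the
recurrence on this range alone allows its use where Pascal's rule fails at 0. -/
theorem tripleConv_right {e f g g₁ g₂ : ℤ → ℂ} {c : ℂ} {a : ℤ} (he : VanishesNeg e)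
    (hf : VanishesNeg f) (h : ∀ n, a ≤ n → g n = g₁ n + c * g₂ (n - 1)) (k : ℤ) :
    tripleConv e f g k a = tripleConv e f g₁ k a + c * tripleConv e f g₂ (k - 1) (a - 1) := by
  unfold tripleConv
  rw [← finsum_add_const_mul (tripleConv_finite he hf g₁ k a)
    (tripleConv_finite he hf g₂ (k - 1) (a - 1))]
  refine finsum_congr fun A => ?_
  rcases lt_or_ge A 0 with hA | hA
  · simp [hf A hA]
  rw [h _ (by omega), show k - 1 - 2 * A - (a - 1) = k - 2 * A - a by ring,
    show A + (a - 1) = A + a - 1 by ring]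
  ring

theorem tripleConv_congr {e f g e' f' g' : ℤ → ℂ} {k a : ℤ} {c : ℂ}
    (h : ∀ A, e (k - 2 * A - a) * f A * g (A + a) =
      c * (e' (k - 2 * A - a) * f' A * g' (A + a))) :
    tripleConv e f g k a = c * tripleConv e' f' g' k a := by
  unfold tripleConv
  rw [mul_finsum]
  exact finsum_congr h

theorem tripleConv_eq_zero {e f g : ℤ → ℂ} {k a : ℤ}
    (h : ∀ A, e (k - 2 * A - a) * f A * g (A + a) = 0) : tripleConv e f g k a = 0 := by
  unfold tripleConv
  rw [finsum_congr h, finsum_zero]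

theorem tripleConv_of_neg {e f g : ℤ → ℂ} {k : ℤ} (he : VanishesNeg e) (hf : VanishesNeg f)
    (hg : VanishesNeg g) (hk : k < 0) (a : ℤ) : tripleConv e f g k a = 0 := by
  refine tripleConv_eq_zero fun A => ?_
  by_cases h1 : k - 2 * A - a < 0
  · simp [he _ h1]
  by_cases h2 : A < 0
  · simp [hf _ h2]
  have h3 : A + a < 0 := by omega
  simp [hg _ h3]

theorem tripleConv_zero {e f g : ℤ → ℂ} {a : ℤ} (he : VanishesNeg e) (hf : VanishesNeg f)
    (hg : VanishesNeg g) (ha : a ≠ 0) : tripleConv e f g 0 a = 0 := by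
  refine tripleConv_eq_zero fun A => ?_
  by_cases h1 : 0 - 2 * A - a < 0
  · rw [he _ h1, zero_mul, zero_mul]
  by_cases h2 : A < 0
  · simp [hf _ h2]
  have h3 : A + a < 0 := by omega
  simp [hg _ h3]

theorem tripleConv_zero_zero {e f g : ℤ → ℂ} (he : VanishesNeg e) (hf : VanishesNeg f) :
    tripleConv e f g 0 0 = e 0 * f 0 * g 0 := by
  unfold tripleConv
  rw [finsum_eq_single _ 0]
  · simp
  · intro A hA
    by_cases h1 : A < 0
    · simp [hf _ h1]
    have : 0 - 2 * A - 0 < 0 := by omega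
    rw [he _ this, zero_mul, zero_mul]

theorem tripleConv_swap (e f g : ℤ → ℂ) (k a : ℤ) :
    tripleConv e f g k a = tripleConv e g f k (-a) := by
  unfold tripleConv
  rw [← finsum_comp_equiv (Equiv.addRight a)
    (f := fun A => e (k - 2 * A - -a) * g A * f (A + -a))]
  refine finsum_congr fun A => ?_
  simp only [Equiv.coe_addRight]
  rw [show k - 2 * (A + a) - -a = k - 2 * A - a by ring, show A + a + -a = A by ring]
  ring

/-- The function `n ↦ p ^ n f n`. -/
def dilate (p : ℂ) (f : ℤ → ℂ) (n : ℤ) : ℂ := p ^ n * f n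

theorem VanishesNeg.dilate {f : ℤ → ℂ} (hf : VanishesNeg f) (p : ℂ) : VanishesNeg (dilate p f) :=
  fun n hn => by rw [RefinedTrinomial.dilate, hf n hn, mul_zero]

theorem tripleConv_dilate {p : ℂ} (hp : p ≠ 0) (e f g : ℤ → ℂ) (k a : ℤ) :
    tripleConv (dilate p e) (dilate p f) (dilate p g) k a = p ^ k * tripleConv e f g k a := by
  refine tripleConv_congr fun A => ?_
  have : p ^ k = p ^ (k - 2 * A - a) * p ^ A * p ^ (A + a) := by
    rw [← zpow_add₀ hp, ← zpow_add₀ hp]; congr 1; ring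
  rw [this]; simp only [dilate]; ring

/-- The Kronecker delta at `0`. -/
def delta (n : ℤ) : ℂ := if n = 0 then 1 else 0

theorem vanishesNeg_delta : VanishesNeg delta := fun _ hn => if_neg hn.ne

theorem vanishesNeg_gauss (p : ℂ) (P : ℤ) : VanishesNeg (gauss p P) :=
  fun _ h => gauss_of_right_neg _ h

/-- `s ^ (n ^ 2)` times the Gaussian binomial coefficient with entries `N` and `n`, in base
`s ^ 2`. -/
def ebin (s : ℂ) (N n : ℤ) : ℂ := s ^ (n ^ 2) * qBinom (s ^ 2) N n

theorem vanishesNeg_ebin (s : ℂ) (N : ℤ) : VanishesNeg (ebin s N) := fun n h => by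
  rw [ebin, qBinom, if_neg (by omega), mul_zero]

theorem ebin_of_lt (s : ℂ) {N n : ℤ} (h : N < n) : ebin s N n = 0 := by
  rw [ebin, qBinom, if_neg (by omega), mul_zero]

theorem ebin_zero {s : ℂ} : ebin s 0 = delta := by
  funext n
  rcases eq_or_ne n 0 with rfl | h
  · simp [ebin, delta, qBinom, qPoch_zero]
  · rw [ebin, delta, qBinom, if_neg (by omega), if_neg h, mul_zero]

theorem sq_zpow_eq {s : ℂ} (n : ℤ) : (s ^ 2) ^ n = s ^ (2 * n) := by
  rw [zpow_mul]; norm_cast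

/-- The generating function is (-sx; s²)_N for N ≥ 0, and its last factor 1 + s^(2N-1) x splits off.
In `ebin_step'` the first factor 1 + sx splits off, and x becomes s²x in the rest, which is
`dilate`. -/
theorem ebin_step {s : ℂ} (hs : s ≠ 0) (hp : Generic (s ^ 2)) {N : ℤ} (hN : N ≠ 0) (n : ℤ) :
    ebin s N n = ebin s (N - 1) n + s ^ (2 * N - 1) * ebin s (N - 1) (n - 1) := by
  simp only [ebin, qBinom_eq_gauss]
  rw [gauss_pascal hp (by omega), sq_zpow_eq, show N - n - 1 = N - 1 - n by ring,
    show N - 1 - (n - 1) = N - n by ring, mul_add, ← mul_assoc, ← mul_assoc, ← zpow_add₀ hs,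
    ← zpow_add₀ hs]
  ring_nf

theorem ebin_step' {s : ℂ} (hs : s ≠ 0) (hp : Generic (s ^ 2)) {N : ℤ} (hN : N ≠ 0) (n : ℤ) :
    ebin s N n = dilate (s ^ 2) (ebin s (N - 1)) n
      + s * dilate (s ^ 2) (ebin s (N - 1)) (n - 1) := by
  simp only [ebin, qBinom_eq_gauss, dilate]
  rw [gauss_pascal' hp (by omega), sq_zpow_eq, sq_zpow_eq, show N - n - 1 = N - 1 - n by ring,
    show N - 1 - (n - 1) = N - n by ring]
  have : s * (s ^ (2 * (n - 1)) * (s ^ (n - 1) ^ 2 * gauss (s ^ 2) (N - n) (n - 1))) =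
      s ^ (n ^ 2) * gauss (s ^ 2) (N - n) (n - 1) := by
    rw [← mul_assoc, ← mul_assoc]
    congr 1
    rw [← zpow_one_add₀ hs, ← zpow_add₀ hs]
    congr 1; ring
  rw [this]; ring

/-- For P ≥ 0 the generating function is 1/(x; p)_(P+1). Its last factor is cancelled here, its
first factor 1 - x in `gauss_step'`. -/
theorem gauss_step {p : ℂ} (hp : Generic p) {P : ℤ} (hP : P ≠ 0) (n : ℤ) :
    gauss p (P - 1) n = gauss p P n + (-p ^ P) * gauss p P (n - 1) := by
  rw [gauss_pascal hp (P := P) (A := n) (Or.inl hP)]; ring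

theorem gauss_step' {p : ℂ} (hp : Generic p) {P : ℤ} (hP : P ≠ 0) (n : ℤ) :
    dilate p (gauss p (P - 1)) n = gauss p P n + (-1) * gauss p P (n - 1) := by
  rw [gauss_pascal' hp (P := P) (A := n) (Or.inl hP), dilate]; ring

theorem delta_step {p : ℂ} (hp : Generic p) (n : ℤ) :
    delta n = gauss p 0 n + (-1) * gauss p 0 (n - 1) := by
  rcases lt_trichotomy n 0 with h | rfl | h
  · rw [gauss_of_right_neg _ h, gauss_of_right_neg _ (by omega), delta, if_neg h.ne]; simp
  · rw [gauss_zero_left hp le_rfl, gauss_of_right_neg _ (by omega), delta]; simp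
  · rw [gauss_zero_left hp h.le, gauss_zero_left hp (by omega), delta, if_neg h.ne']; simp

/-! ### The companion refined trinomial coefficients and their recurrences -/

/-- The refined trinomial coefficient `𝒯(k, M; a, b)` in base `s ^ 2`. -/
def refinedT (s : ℂ) (k M a b : ℤ) : ℂ :=
  tripleConv (ebin s M) (gauss (s ^ 2) (M + b)) (gauss (s ^ 2) (M - b)) k a

theorem refinedT_of_neg {s : ℂ} {k : ℤ} (hk : k < 0) (M a b : ℤ) : refinedT s k M a b = 0 :=
  tripleConv_of_neg (vanishesNeg_ebin s _) (vanishesNeg_gauss _ _) (vanishesNeg_gauss _ _) hk a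

theorem refinedT_of_lt {s : ℂ} {M b : ℤ} (h : M < |b|) (k a : ℤ) : refinedT s k M a b = 0 := by
  refine tripleConv_eq_zero fun A => ?_
  rcases lt_abs.1 h with h | h
  · rw [gauss_of_left_neg (by omega : M - b < 0), mul_zero]
  · rw [gauss_of_left_neg (by omega : M + b < 0), mul_zero, zero_mul]

theorem refinedT_neg_neg (s : ℂ) (k M a b : ℤ) : refinedT s k M (-a) (-b) = refinedT s k M a b := by
  rw [refinedT, tripleConv_swap, neg_neg, refinedT, sub_neg_eq_add, ← sub_eq_add_neg]

theorem refinedT_zero {s : ℂ} {a : ℤ} (ha : a ≠ 0) (M b : ℤ) : refinedT s 0 M a b = 0 :=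
  tripleConv_zero (vanishesNeg_ebin s _) (vanishesNeg_gauss _ _) (vanishesNeg_gauss _ _) ha

/-- For `k < |a|` the coefficient is zero. -/
theorem refinedT_of_lt_abs {s : ℂ} {k a : ℤ} (h : k < |a|) (M b : ℤ) :
    refinedT s k M a b = 0 := by
  refine tripleConv_eq_zero fun A => ?_
  by_cases h1 : k - 2 * A - a < 0
  · rw [vanishesNeg_ebin _ _ _ h1, zero_mul, zero_mul]
  by_cases h2 : A < 0
  · rw [vanishesNeg_gauss _ _ _ h2, mul_zero, zero_mul]
  have h3 : A + a < 0 := by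
    rcases lt_abs.1 h with h | h <;> omega
  rw [vanishesNeg_gauss _ _ _ h3, mul_zero]

/-- The general convolution of which `refinedT` is a special case. -/
def tri (s : ℂ) (N P Q k a : ℤ) : ℂ :=
  tripleConv (ebin s N) (gauss (s ^ 2) P) (gauss (s ^ 2) Q) k a

theorem tri_left (hs : s ≠ 0) (hp : Generic (s ^ 2)) {N : ℤ} (hN : N ≠ 0) (P Q k a : ℤ) :
    tri s N P Q k a = tri s (N - 1) P Q k a + s ^ (2 * N - 1) * tri s (N - 1) P Q (k - 1) a :=
  tripleConv_left (vanishesNeg_ebin s _) (vanishesNeg_ebin s _) (vanishesNeg_gauss _ _)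
    (ebin_step hs hp hN) _ k a

theorem tri_mid (hp : Generic (s ^ 2)) {P : ℤ} (hP : P ≠ 0) (N Q k a : ℤ) :
    tri s N (P - 1) Q k a = tri s N P Q k a + (-(s ^ 2) ^ P) * tri s N P Q (k - 1) (a + 1) :=
  tripleConv_mid (vanishesNeg_ebin s _) (vanishesNeg_gauss _ _) (vanishesNeg_gauss _ _)
    (gauss_step hp hP) _ k a

/-- The empty product 1/(x; p)_0 = 1 would have constant term 1, whereas `gauss p (-1) 0` is 0. Away
from `n = 0` the two agree. -/
theorem gauss_neg_one_step {p : ℂ} (hp : Generic p) {n : ℤ} (hn : 0 < n) :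
    gauss p (0 - 1) n = gauss p 0 n + (-p ^ (0 : ℤ)) * gauss p 0 (n - 1) := by
  rw [gauss_of_left_neg (by norm_num), gauss_zero_left hp hn.le, gauss_zero_left hp (by omega)]
  simp

/-- For `Q = 0` the condition `0 < a` keeps the index `A + a` away from 0, where the step down to -1
fails. -/
theorem tri_right (hp : Generic (s ^ 2)) {Q a : ℤ} (hQ : Q ≠ 0 ∨ 0 < a) (N P k : ℤ) :
    tri s N P (Q - 1) k a = tri s N P Q k a + (-(s ^ 2) ^ Q) * tri s N P Q (k - 1) (a - 1) := by
  refine tripleConv_right (vanishesNeg_ebin s _) (vanishesNeg_gauss _ _) (fun n hn => ?_) k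
  by_cases h : Q = 0
  · subst h
    exact gauss_neg_one_step hp (by omega)
  · exact gauss_step hp h n

theorem refinedT_eq_tri (s : ℂ) (k M a b : ℤ) :
    refinedT s k M a b = tri s M (M + b) (M - b) k a := rfl

/-- The recurrence at `b = 0`. -/
theorem refinedT_recurrence (hs : s ≠ 0) (hp : Generic (s ^ 2)) {M : ℤ} (hM : M ≠ 0) (k a : ℤ) :
    refinedT s k M a 0 - s ^ (2 * M) * refinedT s (k - 1) M (a + 1) 0
      - s ^ (2 * M) * refinedT s (k - 1) M (a - 1) 0 + s ^ (4 * M) * refinedT s (k - 2) M a 0 =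
    refinedT s k (M - 1) a 0 + s ^ (2 * M - 1) * refinedT s (k - 1) (M - 1) a 0 := by
  simp only [refinedT_eq_tri, add_zero, sub_zero]
  -- Both sides are the coefficient in (-sx; s²)_M / ((x/z; s²)_M (xz; s²)_M): on the left the last
  -- factor of each denominator is cancelled, on the right the last numerator factor is split off.
  rw [← tri_left hs hp hM, tri_mid hp hM, tri_right hp (Or.inl hM), tri_right hp (Or.inl hM),
    sq_zpow_eq, show k - 1 - 1 = k - 2 by ring, add_sub_cancel_right]
  have : s ^ (4 * M) = s ^ (2 * M) * s ^ (2 * M) := by rw [← zpow_add₀ hs]; congr 1; ring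
  rw [this]; ring

/-- For `M = 0` the generating function is 1/((1 - x/z)(1 - xz)). Multiplied by its denominator it
is 1, which has no term with `k ≠ 0`. -/
theorem refinedT_recurrence_zero (hp : Generic (s ^ 2)) {k : ℤ} (hk : k ≠ 0) (a : ℤ) :
    refinedT s k 0 a 0 - refinedT s (k - 1) 0 (a + 1) 0
      - refinedT s (k - 1) 0 (a - 1) 0 + refinedT s (k - 2) 0 a 0 = 0 := by
  have key : tripleConv delta delta delta k a = 0 := by
    refine tripleConv_eq_zero fun A => ?_
    by_cases h1 : A = 0
    · by_cases h2 : A + a = 0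
      · rw [delta, if_neg (by omega), zero_mul, zero_mul]
      · rw [show delta (A + a) = 0 from if_neg h2, mul_zero]
    · rw [show delta A = 0 from if_neg h1, mul_zero, zero_mul]
  have r1 : ∀ k a, tripleConv delta delta delta k a = _ := fun k a =>
    tripleConv_mid vanishesNeg_delta (vanishesNeg_gauss _ _) (vanishesNeg_gauss _ _)
    (delta_step hp) delta k a
  have r2 : ∀ k a, tripleConv delta (gauss (s ^ 2) 0) delta k a = _ := fun k a =>
    tripleConv_right vanishesNeg_delta (vanishesNeg_gauss _ _)
    (fun n _ => delta_step hp n) k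
  rw [r1, r2, r2] at key
  simp only [refinedT, ebin_zero, add_zero, sub_zero]
  rw [show k - 1 - 1 = k - 2 by ring, add_sub_cancel_right] at key
  linear_combination key

/-- A recurrence that raises `b` at the same `k`. -/
theorem refinedT_raise_left (hs : s ≠ 0) (hp : Generic (s ^ 2)) {a b : ℤ} (ha : 0 ≤ a)
    (hb : 0 ≤ b) (k M : ℤ) :
    refinedT s k M a (b + 1) - s ^ (2 * (b + 1 + M)) * refinedT s (k - 1) M (a + 1) (b + 1)
      + s ^ (2 * b + 1) * refinedT s k (M - 1) (a + 1) (b + 1) =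
    s ^ (2 * b + 1) * refinedT s k M (a + 1) b - s ^ (2 * M + 1) * refinedT s (k - 1) M a b
      + refinedT s k (M - 1) a b := by
  rcases lt_trichotomy M b with h | rfl | h
  · have h1 : M < |b| := by rw [abs_of_nonneg hb]; exact h
    have h2 : M < |b + 1| := by rw [abs_of_nonneg (by omega)]; omega
    have h3 : M - 1 < |b| := by omega
    have h4 : M - 1 < |b + 1| := by omega
    simp only [refinedT_of_lt h1, refinedT_of_lt h2, refinedT_of_lt h3, refinedT_of_lt h4]
    ring
  -- Only the two terms with `M - b = 0` survive. They cancel because (1 - xz) · 1/(1 - xz) leaves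
  -- no positive power of z.
  · have h2 : M < |M + 1| := by rw [abs_of_nonneg (by omega)]; omega
    have h3 : M - 1 < |M| := by rw [abs_of_nonneg hb]; omega
    have h4 : M - 1 < |M + 1| := by omega
    simp only [refinedT_of_lt h2, refinedT_of_lt h3, refinedT_of_lt h4]
    have := tri_right (s := s) hp (Q := 0) (a := a + 1) (Or.inr (by omega)) M (M + M) k
    have h0 : tri s M (M + M) (0 - 1) k (a + 1) = 0 := tripleConv_eq_zero fun A => by
      rw [gauss_of_left_neg (by norm_num : (0 : ℤ) - 1 < 0), mul_zero]
    rw [h0, add_sub_cancel_right] at this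
    simp only [refinedT_eq_tri, sub_self]
    simp only [zpow_zero] at this
    linear_combination s ^ (2 * M + 1) * this
  · have hM : M ≠ 0 := by omega
    have hP : M + b ≠ 0 := by omega
    have hP' : M + b + 1 ≠ 0 := by omega
    have hQ : M - b ≠ 0 := by omega
    simp only [refinedT_eq_tri]
    -- Every term reduces to `tri s (M - 1) (M + b) (M - b)` at shifted arguments. In `e5` the entry
    -- `M - b - 1` may be 0, and there `a + 1 > 0` is used.
    have e1 := tri_mid hp hP' M (M - b - 1) k a
    have e2 := fun k a => tri_left hs hp hM (M + b) (M - b) k a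
    have e3 := fun k a => tri_right hp (a := a) (Or.inl hQ) M (M + b) k
    have e4 := fun k a => tri_right hp (a := a) (Or.inl hQ) (M - 1) (M + b) k
    have e5 := tri_right hp (Q := M - b - 1) (a := a + 1) (Or.inr (by omega)) (M - 1) (M + b) k
    have e6 := tri_mid hp hP (M - 1) (M - b - 1) k a
    simp only [add_sub_cancel_right] at e1 e5
    rw [show M + (b + 1) = M + b + 1 by ring, show M - (b + 1) = M - b - 1 by ring,
      show M - 1 + (b + 1) = M + b by ring, show M - 1 - (b + 1) = M - b - 1 - 1 by ring,
      show M - 1 + b = M + b - 1 by ring, show M - 1 - b = M - b - 1 by ring, e5, e6]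
    have e7 : tri s M (M + b + 1) (M - b - 1) k a - s ^ (2 * (b + 1 + M)) *
        tri s M (M + b + 1) (M - b - 1) (k - 1) (a + 1) = tri s M (M + b) (M - b - 1) k a := by
      rw [e1, sq_zpow_eq, show b + 1 + M = M + b + 1 by ring]; ring
    rw [e7, e3]
    simp only [e2, e4, sq_zpow_eq, add_sub_cancel_right]
    have z1 : s ^ (2 * M - 1) = s ^ (2 * (M - b)) * s ^ (2 * b) * s⁻¹ := by
      rw [← zpow_add₀ hs, ← zpow_sub_one₀ hs]; congr 1; ring
    have z2 : s ^ (2 * M + 1) = s ^ (2 * (M - b)) * s ^ (2 * b) * s := by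
      rw [← zpow_add₀ hs, ← zpow_add_one₀ hs]; congr 1; ring
    have z3 : s ^ (2 * b + 1) = s ^ (2 * b) * s := by rw [← zpow_add_one₀ hs]
    have z4 : s ^ (2 * (M - b - 1)) = s ^ (2 * (M - b)) * s⁻¹ ^ 2 := by
      rw [show 2 * (M - b - 1) = 2 * (M - b) - 1 - 1 by ring, zpow_sub_one₀ hs, zpow_sub_one₀ hs]
      ring
    have z5 : s ^ (2 * (M + b)) = s ^ (2 * (M - b)) * (s ^ (2 * b)) ^ 2 := by
      rw [← zpow_natCast (s ^ (2 * b)), ← zpow_mul, ← zpow_add₀ hs]; congr 1; push_cast; ring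
    rw [z1, z2, z3, z4, z5]
    field_simp
    ring

/-- A recurrence that raises `b`, in the form used with `k` as summation index. -/
theorem refinedT_raise_right (hs : s ≠ 0) (hp : Generic (s ^ 2)) {a b : ℤ} (ha : 0 ≤ a)
    (hb : 0 ≤ b) (k M : ℤ) :
    s ^ (2 * a + 1) * refinedT s k M a (b + 1)
      + s ^ (2 * (a + 1 + k)) * refinedT s k (M - 1) (a + 1) (b + 1)
      - s ^ (2 * a + 1) * refinedT s (k - 1) M (a + 1) (b + 1) =
    refinedT s k M (a + 1) b + s ^ (2 * k + 1) * refinedT s k (M - 1) a b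
      - refinedT s (k - 1) M a b := by
  rcases lt_trichotomy M b with h | rfl | h
  · have h1 : M < |b| := by rw [abs_of_nonneg hb]; exact h
    have h2 : M < |b + 1| := by rw [abs_of_nonneg (by omega)]; omega
    have h3 : M - 1 < |b| := by omega
    have h4 : M - 1 < |b + 1| := by omega
    simp only [refinedT_of_lt h1, refinedT_of_lt h2, refinedT_of_lt h3, refinedT_of_lt h4]
    ring
  · have h2 : M < |M + 1| := by rw [abs_of_nonneg (by omega)]; omega
    have h3 : M - 1 < |M| := by rw [abs_of_nonneg hb]; omega
    have h4 : M - 1 < |M + 1| := by omega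
    simp only [refinedT_of_lt h2, refinedT_of_lt h3, refinedT_of_lt h4]
    have := tri_right (s := s) hp (Q := 0) (a := a + 1) (Or.inr (by omega)) M (M + M) k
    have h0 : tri s M (M + M) (0 - 1) k (a + 1) = 0 := tripleConv_eq_zero fun A => by
      rw [gauss_of_left_neg (by norm_num : (0 : ℤ) - 1 < 0), mul_zero]
    rw [h0, add_sub_cancel_right] at this
    simp only [refinedT_eq_tri, sub_self]
    simp only [zpow_zero] at this
    linear_combination this
  have hp0 := hp.ne_zero
  have hM : M ≠ 0 := by omega
  have hP : M + b ≠ 0 := by omega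
  have hP' : M + b + 1 ≠ 0 := by omega
  have hQ : M - b ≠ 0 := by omega
  set p := s ^ 2 with hpdef
  -- The coefficients of (-s³x; p)_(M-1) / ((x/z; p)_(M+b+1) (pxz; p)_(M-b)), to which `X1`–`X4`
  -- reduce all six terms.
  set C : ℤ → ℤ → ℂ := fun k a => tripleConv (dilate p (ebin s (M - 1))) (gauss p (M + b))
    (dilate p (gauss p (M - b - 1))) k a with hC
  have X0 : ∀ k a, tripleConv (ebin s M) (gauss p (M + b)) (dilate p (gauss p (M - b - 1))) k a =
      C k a + s * C (k - 1) a := fun k a =>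
    tripleConv_left ((vanishesNeg_ebin _ _).dilate _) ((vanishesNeg_ebin _ _).dilate _)
      (vanishesNeg_gauss _ _) (ebin_step' hs hp hM) _ k a
  have X1 : p ^ a * refinedT s k M a (b + 1) - p ^ a * refinedT s (k - 1) M (a + 1) (b + 1) =
      C k a + s * C (k - 1) a := by
    rw [← X0, tripleConv_mid (f₁ := dilate p⁻¹ (gauss p (M + b + 1)))
      (f₂ := dilate p⁻¹ (gauss p (M + b + 1))) (c := -p⁻¹) (vanishesNeg_ebin _ _)
      ((vanishesNeg_gauss _ _).dilate _) ((vanishesNeg_gauss _ _).dilate _) (fun n => ?_)]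
    -- The weights p^(-A) and p^(A+a) multiply to p^a, which does not depend on the summation index.
    · have w : ∀ k a, tripleConv (ebin s M) (dilate p⁻¹ (gauss p (M + b + 1)))
          (dilate p (gauss p (M - b - 1))) k a = p ^ a * refinedT s k M a (b + 1) := fun k a => by
        rw [refinedT, ← hpdef, ← add_assoc, ← sub_sub]
        refine tripleConv_congr fun A => ?_
        simp only [dilate]
        rw [zpow_add₀ hp0, inv_zpow]
        field_simp
      rw [w, w, zpow_add_one₀ hp0]
      field_simp
      ring
    · have := gauss_step' hp hP' n
      rw [add_sub_cancel_right, dilate] at this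
      simp only [dilate]
      rw [zpow_sub_one₀ (inv_ne_zero hp0), inv_inv, inv_zpow]
      have hn := zpow_ne_zero n hp0
      field_simp
      linear_combination this
  have X2 : refinedT s k M (a + 1) b - refinedT s (k - 1) M a b =
      C k (a + 1) + s * C (k - 1) (a + 1) := by
    rw [← X0, tripleConv_right (vanishesNeg_ebin _ _) (vanishesNeg_gauss _ _)
      (fun n _ => gauss_step' hp hQ n), add_sub_cancel_right]
    simp only [refinedT, ← hpdef]
    ring
  have X3 : p ^ k * refinedT s k (M - 1) a b = C k a - C (k - 1) (a + 1) := by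
    rw [refinedT, ← hpdef, ← tripleConv_dilate hp0, show M - 1 + b = M + b - 1 by ring,
      tripleConv_mid ((vanishesNeg_ebin _ _).dilate _) (vanishesNeg_gauss _ _)
        (vanishesNeg_gauss _ _) (gauss_step' hp hP), show M - 1 - b = M - b - 1 by ring]
    ring
  have X4 : p ^ (a + 1 + k) * refinedT s k (M - 1) (a + 1) (b + 1) =
      C k (a + 1) - p * C (k - 1) a := by
    have w : tripleConv (dilate p (ebin s (M - 1))) (gauss p (M + b))
          (dilate p (dilate p (gauss p (M - b - 1 - 1)))) k (a + 1)
        = p ^ (a + 1 + k) * refinedT s k (M - 1) (a + 1) (b + 1) := by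
      rw [refinedT, ← hpdef, show M - 1 + (b + 1) = M + b by ring,
        show M - 1 - (b + 1) = M - b - 1 - 1 by ring]
      refine tripleConv_congr fun A => ?_
      simp only [dilate]
      have : p ^ (a + 1 + k) = p ^ (k - 2 * A - (a + 1)) * p ^ (A + (a + 1)) *
          p ^ (A + (a + 1)) := by
        rw [← zpow_add₀ hp0, ← zpow_add₀ hp0]; congr 1; ring
      rw [this]; ring
    rw [← w, tripleConv_right (g₁ := dilate p (gauss p (M - b - 1)))
      (g₂ := dilate p (gauss p (M - b - 1))) (c := -p) ((vanishesNeg_ebin _ _).dilate _)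
      (vanishesNeg_gauss _ _) (fun n hn => ?_), add_sub_cancel_right]
    · ring
    · simp only [dilate]
      rw [zpow_sub_one₀ hp0]
      by_cases h0 : M - b - 1 = 0
      · have := gauss_neg_one_step hp (n := n) (by omega)
        rw [h0, this, zpow_zero, gauss_zero_left hp (by omega), gauss_zero_left hp (by omega)]
        field_simp
        ring
      · have := gauss_step' hp h0 n
        rw [dilate] at this
        rw [this]
        field_simp
  rw [hpdef, sq_zpow_eq] at X1 X3 X4
  rw [zpow_add_one₀ hs, zpow_add_one₀ hs]
  linear_combination s * X1 + X4 - X2 - s * X3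

/-! ### The recurrences of the refined coefficients `𝒮` -/

/-- The convolution that equals `𝒮` up to a power of `s`. -/
def kap (s : ℂ) (M b L c : ℤ) : ℂ :=
  tripleConv (gauss (s ^ 2) M) (ebin s (M - b)) (ebin s (M + b)) L c

theorem finsum_eq_finsum_comp {α β : Type*} {g : β → α} (hg : Function.Injective g) {f : α → ℂ}
    (h : ∀ x, x ∉ Set.range g → f x = 0) : ∑ᶠ x, f x = ∑ᶠ y, f (g y) := by
  rw [← finsum_mem_range hg]
  refine finsum_congr fun x => ?_
  by_cases hx : x ∈ Set.range g
  · simp only [eq_true hx, finsum_true]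
  · simp only [eq_false hx, finsum_false, h x hx]

theorem finsum_int_eq_finsum_nat {f : ℤ → ℂ} (hf : VanishesNeg f) :
    ∑ᶠ n : ℤ, f n = ∑ᶠ n : ℕ, f n := by
  refine finsum_eq_finsum_comp Nat.cast_injective fun x hx => hf x ?_
  by_contra h
  exact hx ⟨x.toNat, by omega⟩

/-- Completing squares, a² + 2n(n + a) = n² + (n + a)². So 𝒮 comes from (-sx/z; s²)_(M-b') (-sxz;
s²)_(M+b') / (x; s²)_(M+1) with b' = a - b. -/
theorem refinedS_eq_kap (hs : s ≠ 0) (L M a b : ℤ) :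
    s ^ (a ^ 2) * refinedS L M a b (s ^ 2) = kap s M (a - b) L a := by
  rw [kap, tripleConv, finsum_int_eq_finsum_nat, refinedS, mul_finsum]
  · refine finsum_congr fun n => ?_
    rw [refinedSTerm, gauss_symm, gauss, ebin, ebin,
      show L - 2 * (n : ℤ) - a + M = M + L - a - 2 * n by ring,
      show M - (a - b) = M - a + b by ring, show M + (a - b) = M + a - b by ring, sq_zpow_eq]
    have : s ^ (a ^ 2) * s ^ (2 * ((n : ℤ) * (n + a))) =
        s ^ ((n : ℤ) ^ 2) * s ^ (((n : ℤ) + a) ^ 2) := by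
      rw [← zpow_add₀ hs, ← zpow_add₀ hs]; congr 1; ring
    linear_combination qBinom (s ^ 2) (M + L - a - 2 * n) M * qBinom (s ^ 2) (M - a + b) n *
      qBinom (s ^ 2) (M + a - b) (n + a) * this
  · intro n hn
    simp only [vanishesNeg_ebin _ _ _ hn, mul_zero, zero_mul]

/-- Both sides are the convolution with numerator lengths M - b and M + b + 1; each splits off the
last factor of one numerator. -/
theorem kap_raise (hs : s ≠ 0) (hp : Generic (s ^ 2)) {M b : ℤ} (h1 : M ≠ b) (h2 : M + b + 1 ≠ 0)
    (L c : ℤ) :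
    kap s M (b + 1) L c + s ^ (2 * (M - b) - 1) * kap s M (b + 1) (L - 1) (c + 1) =
      kap s M b L c + s ^ (2 * (M + b) + 1) * kap s M b (L - 1) (c - 1) := by
  have e1 := tripleConv_mid (vanishesNeg_gauss (s ^ 2) M) (vanishesNeg_ebin s _)
    (vanishesNeg_ebin s _) (ebin_step hs hp (sub_ne_zero.2 h1)) (ebin s (M + b + 1)) L c
  have e2 := tripleConv_right (a := c) (vanishesNeg_gauss (s ^ 2) M) (vanishesNeg_ebin s (M - b))
    (fun n _ => ebin_step hs hp h2 n) L
  rw [add_sub_cancel_right, show 2 * (M + b + 1) - 1 = 2 * (M + b) + 1 by ring] at e2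
  simp only [kap]
  rw [← sub_sub, ← add_assoc, ← e1, ← e2]

/-- Removing the first factor of each of the three products leaves the generating function for M - 1
at s²x. -/
theorem kap_recurrence (hs : s ≠ 0) (hp : Generic (s ^ 2)) {M : ℤ} (hM : M ≠ 0) (L c : ℤ) :
    kap s M 0 L c - s ^ (2 * L) * kap s (M - 1) 0 L c
      - s ^ (2 * L - 1) * (kap s (M - 1) 0 (L - 1) (c + 1) + kap s (M - 1) 0 (L - 1) (c - 1)) =
    kap s M 0 (L - 1) c + s ^ (2 * L - 2) * kap s (M - 1) 0 (L - 2) c := by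
  have hp0 := hp.ne_zero
  have v1 := vanishesNeg_gauss (s ^ 2) M
  have v2 := vanishesNeg_ebin s M
  have v3 := (vanishesNeg_gauss (s ^ 2) (M - 1)).dilate (s ^ 2)
  have v4 := (vanishesNeg_ebin s (M - 1)).dilate (s ^ 2)
  have e1 := tripleConv_left v1 v1 v2 (gauss_step' hp hM) (ebin s M) L c
  have e2 := tripleConv_mid v3 v4 v4 (ebin_step' hs hp hM) (ebin s M) L c
  have e3 := fun k a => tripleConv_right (a := a) v3 v4 (fun n _ => ebin_step' hs hp hM n) k
  rw [e2, e3, e3] at e1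
  simp only [tripleConv_dilate hp0, sq_zpow_eq, add_sub_cancel_right] at e1
  simp only [kap, sub_zero, add_zero]
  have z1 : s ^ (2 * (L - 1)) = s ^ (2 * L) * s⁻¹ ^ 2 := by
    rw [show 2 * (L - 1) = 2 * L - 1 - 1 by ring, zpow_sub_one₀ hs, zpow_sub_one₀ hs]; ring
  have z2 : s ^ (2 * (L - 1 - 1)) = s ^ (2 * L) * s⁻¹ ^ 4 := by
    rw [show 2 * (L - 1 - 1) = 2 * L - 1 - 1 - 1 - 1 by ring]
    iterate 4 rw [zpow_sub_one₀ hs]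
    ring
  have z3 : s ^ (2 * L - 2) = s ^ (2 * L) * s⁻¹ ^ 2 := by
    rw [show 2 * L - 2 = 2 * L - 1 - 1 by ring, zpow_sub_one₀ hs, zpow_sub_one₀ hs]; ring
  rw [z1, z2, show L - 1 - 1 = L - 2 by ring] at e1
  rw [z3, zpow_sub_one₀ hs]
  field_simp at e1 ⊢
  linear_combination -e1

/-! ### Summation kernels as power series -/

/-- The power series with coefficients `t n`, for `n ≥ 0`. -/
def tau (t : ℤ → ℂ) : PowerSeries ℂ := mk fun n => t n

theorem coeff_tau (t : ℤ → ℂ) (n : ℕ) : coeff n (tau t) = t n := coeff_mk _ _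

theorem X_mul_tau {t : ℤ → ℂ} (ht : VanishesNeg t) : X * tau t = tau fun n => t (n - 1) := by
  ext n
  rcases n with _ | n
  · rw [coeff_zero_X_mul, coeff_tau, ht _ (by simp)]
  · rw [coeff_succ_X_mul, coeff_tau, coeff_tau]
    congr 1; push_cast; ring

theorem rescale_tau (p : ℂ) (t : ℤ → ℂ) : rescale p (tau t) = tau (dilate p t) := by
  ext n
  rw [coeff_rescale, coeff_tau, coeff_tau, dilate, zpow_natCast]

theorem C_mul_tau (c : ℂ) (t : ℤ → ℂ) : C c * tau t = tau fun n => c * t n := by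
  ext n
  rw [coeff_C_mul, coeff_tau, coeff_tau]

theorem tau_eq_zero {t : ℤ → ℂ} (h : ∀ n, 0 ≤ n → t n = 0) : tau t = 0 := by
  ext n
  rw [coeff_tau, h _ (by omega), map_zero]

theorem tau_congr {t u : ℤ → ℂ} (h : ∀ n, 0 ≤ n → t n = u n) : tau t = tau u := by
  ext n
  rw [coeff_tau, coeff_tau, h _ (by omega)]

theorem tau_add (t u : ℤ → ℂ) : tau t + tau u = tau fun n => t n + u n := by
  ext n; simp [coeff_tau]

theorem tau_sub (t u : ℤ → ℂ) : tau t - tau u = tau fun n => t n - u n := by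
  ext n; simp [coeff_tau]

/-- The generating function of `gauss p L r`. -/
def kern (p : ℂ) (L : ℤ) : PowerSeries ℂ := tau (gauss p L)

theorem coeff_kern_mul_tau (p : ℂ) (L : ℤ) (t : ℤ → ℂ) (M : ℕ) :
    coeff M (kern p L * tau t) = ∑ i ∈ Finset.range (M + 1), gauss p L (M - i) * t i := by
  rw [mul_comm, coeff_mul, Finset.Nat.sum_antidiagonal_eq_sum_range_succ_mk]
  refine Finset.sum_congr rfl fun i hi => ?_
  have : i ≤ M := by simpa [Nat.lt_succ_iff] using hi
  rw [kern, coeff_tau, coeff_tau, mul_comm, Nat.cast_sub this]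

theorem kern_sub_one {p : ℂ} (hp : Generic p) {L : ℤ} (hL : L ≠ 0) :
    kern p (L - 1) = (1 - C (p ^ L) * X) * kern p L := by
  rw [sub_mul, one_mul, mul_assoc, kern, kern, X_mul_tau (vanishesNeg_gauss _ _), C_mul_tau,
    tau_sub]
  refine tau_congr fun n _ => ?_
  rw [gauss_step hp hL]; ring

theorem rescale_kern_sub_one {p : ℂ} (hp : Generic p) {L : ℤ} (hL : L ≠ 0) :
    rescale p (kern p (L - 1)) = (1 - X) * kern p L := by
  rw [sub_mul, one_mul, kern, kern, X_mul_tau (vanishesNeg_gauss _ _), rescale_tau, tau_sub]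
  refine tau_congr fun n _ => ?_
  rw [gauss_step' hp hL]; ring

/-- For `L = 0` the series `kern p (-1)` is 0, while cancelling 1 - X would give 1. This is harmless
when the other factor vanishes. -/
theorem rescale_kern_mul {p : ℂ} (hp : Generic p) {L : ℤ} {t : ℤ → ℂ}
    (h : L ≠ 0 ∨ tau t = 0) :
    rescale p (kern p (L - 1) * tau t) = kern p L * ((1 - X) * rescale p (tau t)) := by
  rcases h with h | h
  · rw [map_mul, rescale_kern_sub_one hp h]; ring
  · rw [h]; simp

theorem one_sub_C_mul_X_ne_zero (c : ℂ) : (1 - C c * X : PowerSeries ℂ) ≠ 0 := fun h => by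
  have := congrArg (coeff 0) h
  simp at this

theorem one_sub_X_ne_zero : (1 - X : PowerSeries ℂ) ≠ 0 := fun h => by
  have := congrArg (coeff 0) h
  simp at this

theorem kern_zero {p : ℂ} (hp : Generic p) (n : ℕ) : coeff n (kern p 0) = 1 := by
  rw [kern, coeff_tau, gauss_zero_left hp (by omega)]

theorem refinedT_zero_zero (hp : Generic (s ^ 2)) {M : ℤ} (hM : 0 ≤ M) :
    refinedT s 0 M 0 0 = 1 := by
  rw [refinedT, tripleConv_zero_zero (vanishesNeg_ebin _ _) (vanishesNeg_gauss _ _), ebin,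
    qBinom_eq_gauss]
  simp [gauss_zero_right hp hM]

/-! ### The transformation from `𝒯` to `𝒯` -/

/-- The summand of the transformation from `𝒯` to `𝒯`. -/
def summandT (s : ℂ) (L a b i : ℤ) : ℂ := s ^ (i ^ 2) * refinedT s (L - i) i a b

theorem vanishesNeg_summandT (L a b : ℤ) : VanishesNeg (summandT s L a b) := fun i hi => by
  rw [summandT, refinedT_of_lt (hi.trans_le (abs_nonneg b)), mul_zero]

theorem tau_summandT_of_neg {L : ℤ} (hL : L < 0) (a b : ℤ) : tau (summandT s L a b) = 0 :=
  tau_eq_zero fun n hn => by rw [summandT, refinedT_of_neg (by omega), mul_zero]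

/-- The generating function of the left-hand sides. -/
def leftT (s : ℂ) (L a b : ℤ) : PowerSeries ℂ := kern (s ^ 2) L * tau (summandT s L a b)

/-- The generating function of the right-hand sides. -/
def rightT (s : ℂ) (L a b : ℤ) : PowerSeries ℂ :=
  tau fun M => s ^ (b ^ 2) * refinedT s L M (a + b) b

theorem leftT_of_neg {L : ℤ} (hL : L < 0) (a b : ℤ) : leftT s L a b = 0 := by
  rw [leftT, tau_summandT_of_neg hL, mul_zero]

theorem rightT_of_neg {L : ℤ} (hL : L < 0) (a b : ℤ) : rightT s L a b = 0 :=
  tau_eq_zero fun n _ => by rw [refinedT_of_neg hL, mul_zero]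

/-- Coefficientwise this is `refinedT_raise_left` at `k = L - n`, `M = n`. The factors 1 - X are
those of `rescale_kern_mul`, so multiplying by the kernel gives `leftT_raise`. -/
theorem summandT_raise (hs : s ≠ 0) (hp : Generic (s ^ 2)) {a b : ℤ} (ha : 0 ≤ a) (hb : 0 ≤ b)
    (L : ℤ) :
    tau (summandT s L a (b + 1)) - C (s ^ (2 * b + 2)) *
        ((1 - X) * rescale (s ^ 2) (tau (summandT s (L - 1) (a + 1) (b + 1)))) =
      C (s ^ (2 * b + 1)) * tau (summandT s L (a + 1) b) -
        C s * ((1 - X) * rescale (s ^ 2) (tau (summandT s (L - 1) a b))) := by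
  simp only [rescale_tau, sub_mul, one_mul, mul_sub,
    X_mul_tau ((vanishesNeg_summandT _ _ _).dilate _), C_mul_tau, tau_sub]
  refine tau_congr fun n _ => ?_
  have key := refinedT_raise_left hs hp ha hb (L - n) n
  simp only [summandT, dilate, sq_zpow_eq]
  rw [show L - 1 - (n - 1) = L - n by ring, show L - 1 - n = L - n - 1 by ring]
  have z0 : s ^ (n - 1) ^ 2 = s ^ n ^ 2 * s ^ (-2 * n + 1) := by
    rw [← zpow_add₀ hs]; congr 1; ring
  have z1 : s ^ (2 * (n - 1)) = s ^ (2 * n) * s ^ (-2 : ℤ) := by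
    rw [← zpow_add₀ hs]; congr 1; ring
  have z2 : s ^ (-2 * n + 1) = (s ^ (2 * n))⁻¹ * s := by
    rw [← zpow_neg, ← zpow_add_one₀ hs]; congr 1; ring
  have z3 : s ^ (2 * (b + 1 + n)) = s ^ (2 * b) * s ^ 2 * s ^ (2 * n) := by
    rw [← zpow_natCast s 2, ← zpow_add₀ hs, ← zpow_add₀ hs]; congr 1; push_cast; ring
  have z4 : s ^ (2 * b + 2) = s ^ (2 * b) * s ^ 2 := by
    rw [← zpow_natCast s 2, ← zpow_add₀ hs]; rfl
  have z5 : s ^ (-2 : ℤ) = (s ^ 2)⁻¹ := by rw [zpow_neg]; rfl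
  rw [zpow_add_one₀ hs, zpow_add_one₀ hs, z3] at key
  rw [z0, z1, z2, z4, z5, zpow_add_one₀ hs]
  have n1 := zpow_ne_zero (2 * n) hs
  field_simp at key ⊢
  linear_combination key

theorem leftT_raise (hs : s ≠ 0) (hp : Generic (s ^ 2)) {a b : ℤ} (ha : 0 ≤ a) (hb : 0 ≤ b)
    (L : ℤ) :
    leftT s L a (b + 1) - C (s ^ (2 * b + 2)) * rescale (s ^ 2) (leftT s (L - 1) (a + 1) (b + 1)) =
      C (s ^ (2 * b + 1)) * leftT s L (a + 1) b - C s * rescale (s ^ 2) (leftT s (L - 1) a b) := by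
  have h : ∀ a b, L ≠ 0 ∨ tau (summandT s (L - 1) a b) = 0 := fun a b => by
    by_cases hL : L = 0
    · exact Or.inr (tau_summandT_of_neg (by omega) a b)
    · exact Or.inl hL
  simp only [leftT]
  rw [rescale_kern_mul hp (h _ _), rescale_kern_mul hp (h _ _)]
  linear_combination kern (s ^ 2) L * summandT_raise hs hp ha hb L

/-- Up to one power of s, both sides have the coefficients `tri s n (n + b) (n - b - 1) L (a + b +
1)`. -/
theorem rightT_raise (hs : s ≠ 0) (hp : Generic (s ^ 2)) {a b : ℤ} (ha : 0 ≤ a) (hb : 0 ≤ b)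
    (L : ℤ) :
    rightT s L a (b + 1) -
        C (s ^ (2 * b + 2)) * rescale (s ^ 2) (rightT s (L - 1) (a + 1) (b + 1)) =
      C (s ^ (2 * b + 1)) * rightT s L (a + 1) b -
        C s * rescale (s ^ 2) (rightT s (L - 1) a b) := by
  simp only [rightT, rescale_tau, C_mul_tau, tau_sub]
  refine tau_congr fun n hn => ?_
  have hP : n + b + 1 ≠ 0 := by omega
  have e1 := tri_mid hp hP n (n - b - 1) L (a + b + 1)
  have e2 := tri_right hp (Q := n - b) (a := a + b + 1) (Or.inr (by omega)) n (n + b) L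
  rw [add_sub_cancel_right] at e1 e2
  simp only [dilate, sq_zpow_eq] at e1 e2 ⊢
  simp only [refinedT_eq_tri]
  rw [show n + (b + 1) = n + b + 1 by ring, show n - (b + 1) = n - b - 1 by ring,
    show a + (b + 1) = a + b + 1 by ring, show a + 1 + (b + 1) = a + b + 1 + 1 by ring,
    show a + 1 + b = a + b + 1 by ring]
  have z1 : s ^ (b + 1) ^ 2 = s ^ b ^ 2 * (s ^ (2 * b) * s) := by
    rw [← zpow_add_one₀ hs, ← zpow_add₀ hs]; congr 1; ring
  have z2 : s ^ (2 * b + 2) * s ^ (2 * n) = s ^ (2 * (n + b + 1)) := by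
    rw [← zpow_add₀ hs]; congr 1; ring
  have z3 : s ^ (2 * n) = s ^ (2 * (n - b)) * s ^ (2 * b) := by
    rw [← zpow_add₀ hs]; congr 1; ring
  rw [zpow_add_one₀ hs, z1]
  linear_combination s ^ b ^ 2 * (s ^ (2 * b) * s) * (e2 - e1)
    - s ^ b ^ 2 * (s ^ (2 * b) * s) * tri s n (n + b + 1) (n - b - 1) (L - 1) (a + b + 1 + 1) * z2
    + s ^ b ^ 2 * s * tri s n (n + b) (n - b) (L - 1) (a + b) * z3

/-- The factor 1 - s²X is what rescaling the kernel twice yields beyond 1 - X. At `n = 0` the `M =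
0` recurrence applies, as then `k = L ≠ 0`. -/
theorem summandT_recurrence (hs : s ≠ 0) (hp : Generic (s ^ 2)) {L : ℤ} (hL : L ≠ 0) (a : ℤ) :
    tau (summandT s L a 0) - rescale (s ^ 2) (tau (summandT s (L - 1) (a + 1) 0))
        - rescale (s ^ 2) (tau (summandT s (L - 1) (a - 1) 0))
        + (1 - C (s ^ 2) * X) *
          rescale (s ^ 2) (rescale (s ^ 2) (tau (summandT s (L - 2) a 0))) =
      C s * (X * rescale (s ^ 2) (tau (summandT s (L - 1) a 0))) := by
  simp only [rescale_tau, sub_mul, one_mul, mul_assoc,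
    X_mul_tau ((vanishesNeg_summandT _ _ _).dilate _),
    X_mul_tau (((vanishesNeg_summandT _ _ _).dilate _).dilate _), C_mul_tau, tau_sub, tau_add]
  refine tau_congr fun n _ => ?_
  simp only [dilate, summandT, sq_zpow_eq]
  have z0 : s ^ (n - 1) ^ 2 = s ^ n ^ 2 * ((s ^ (2 * n))⁻¹ * s) := by
    rw [← zpow_neg, ← zpow_add_one₀ hs, ← zpow_add₀ hs]; congr 1; ring
  have z1 : s ^ (2 * (n - 1)) = s ^ (2 * n) * (s ^ 2)⁻¹ := by
    rw [← zpow_natCast s 2, ← zpow_neg, ← zpow_add₀ hs]; congr 1; push_cast; ring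
  have z2 : s ^ (4 * n) = s ^ (2 * n) * s ^ (2 * n) := by
    rw [← zpow_add₀ hs]; congr 1; ring
  have n1 := zpow_ne_zero (2 * n) hs
  rw [show L - 1 - (n - 1) = L - n by ring, show L - 2 - (n - 1) = L - n - 1 by ring,
    show L - 1 - n = L - n - 1 by ring, show L - 2 - n = L - n - 2 by ring, z0, z1]
  by_cases hn : n = 0
  · subst hn
    have key := refinedT_recurrence_zero hp (k := L - 0) (by omega) a
    have h0 : ∀ k a, refinedT s k (0 - 1) a 0 = 0 := fun k a => refinedT_of_lt (by norm_num) k a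
    simp only [h0]
    simp only [mul_zero, zpow_zero, one_mul]
    linear_combination s ^ (0 : ℤ) ^ 2 * key
  · have key := refinedT_recurrence hs hp hn (L - n) a
    rw [z2, zpow_sub_one₀ hs] at key
    field_simp at key ⊢
    linear_combination key

theorem leftT_recurrence (hs : s ≠ 0) (hp : Generic (s ^ 2)) {L : ℤ} (hL : 0 < L) (a : ℤ) :
    (1 - X) * leftT s L a 0 - rescale (s ^ 2) (leftT s (L - 1) (a + 1) 0)
        - rescale (s ^ 2) (leftT s (L - 1) (a - 1) 0)
        + rescale (s ^ 2) (rescale (s ^ 2) (leftT s (L - 2) a 0)) =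
      C s * (X * rescale (s ^ 2) (leftT s (L - 1) a 0)) := by
  have h : L - 1 ≠ 0 ∨ tau (summandT s (L - 2) a 0) = 0 := by
    by_cases hL' : L = 1
    · exact Or.inr (tau_summandT_of_neg (by omega) a 0)
    · exact Or.inl (by omega)
  have h2 := rescale_kern_mul hp h
  rw [show L - 1 - 1 = L - 2 by ring] at h2
  simp only [leftT]
  rw [h2]
  simp only [map_mul, map_sub, map_one, rescale_X, rescale_kern_sub_one hp hL.ne']
  linear_combination (1 - X) * kern (s ^ 2) L * summandT_recurrence hs hp hL.ne' a

theorem rightT_recurrence (hs : s ≠ 0) (hp : Generic (s ^ 2)) {L : ℤ} (hL : 0 < L) (a : ℤ) :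
    (1 - X) * rightT s L a 0 - rescale (s ^ 2) (rightT s (L - 1) (a + 1) 0)
        - rescale (s ^ 2) (rightT s (L - 1) (a - 1) 0)
        + rescale (s ^ 2) (rescale (s ^ 2) (rightT s (L - 2) a 0)) =
      C s * (X * rescale (s ^ 2) (rightT s (L - 1) a 0)) := by
  have hr : ∀ L a, rightT s L a 0 = tau fun M => refinedT s L M a 0 := fun L a =>
    tau_congr fun n _ => by simp
  have hv : ∀ L a, VanishesNeg fun M => refinedT s L M a 0 := fun L a M hM =>
    refinedT_of_lt (by simpa using hM) _ _
  simp only [hr, rescale_tau, sub_mul, one_mul, X_mul_tau (hv _ _),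
    X_mul_tau ((hv _ _).dilate _), C_mul_tau, tau_sub, tau_add]
  refine tau_congr fun n _ => ?_
  simp only [dilate, sq_zpow_eq]
  by_cases hn : n = 0
  · subst hn
    have key := refinedT_recurrence_zero hp hL.ne' a
    have h0 : ∀ k a, refinedT s k (0 - 1) a 0 = 0 := fun k a => refinedT_of_lt (by norm_num) k a
    simp only [h0]
    simp only [mul_zero, zpow_zero, one_mul, sub_zero]
    exact key
  · have key := refinedT_recurrence hs hp hn L a
    have z1 : s ^ (2 * n - 1) = s * s ^ (2 * (n - 1)) := by
      rw [← zpow_one_add₀ hs]; congr 1; ring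
    have z2 : s ^ (4 * n) = s ^ (2 * n) * s ^ (2 * n) := by
      rw [← zpow_add₀ hs]; congr 1; ring
    rw [z1, z2] at key
    linear_combination key

theorem leftT_zero_left (hp : Generic (s ^ 2)) (a : ℤ) : leftT s 0 a 0 = rightT s 0 a 0 := by
  have h1 : tau (summandT s 0 a 0) = C (refinedT s 0 0 a 0) := by
    ext n
    rw [coeff_tau, coeff_C, summandT]
    split_ifs with h
    · simp [h]
    · rw [refinedT_of_neg (by omega), mul_zero]
  rw [leftT, h1, rightT]
  ext n
  rw [coeff_mul_C, kern_zero hp, coeff_tau, add_zero]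
  by_cases ha : a = 0
  · subst ha
    rw [refinedT_zero_zero hp le_rfl, refinedT_zero_zero hp (by omega)]; simp
  · rw [refinedT_zero ha, refinedT_zero ha]; simp

/-- The recurrence reaches L - 1 and L - 2 with a shifted by ±1, hence an induction on a bound for L
with all a at once; the leading factor 1 - X cancels. -/
theorem leftT_eq_rightT_zero (hs : s ≠ 0) (hp : Generic (s ^ 2)) (m : ℕ) :
    ∀ L : ℤ, L < m → ∀ a : ℤ, leftT s L a 0 = rightT s L a 0 := by
  induction m with
  | zero => intro L hL a; rw [leftT_of_neg (by omega), rightT_of_neg (by omega)]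
  | succ m ih =>
    intro L hL a
    rcases lt_trichotomy L 0 with h | rfl | h
    · rw [leftT_of_neg h, rightT_of_neg h]
    · exact leftT_zero_left hp a
    · have e1 := leftT_recurrence hs hp h a
      have e2 := rightT_recurrence hs hp h a
      simp only [ih (L - 1) (by omega), ih (L - 2) (by omega)] at e1
      refine mul_left_cancel₀ one_sub_X_ne_zero ?_
      linear_combination e1 - e2

theorem leftT_eq_rightT_aux (hs : s ≠ 0) (hp : Generic (s ^ 2)) (b m : ℕ) :
    ∀ L : ℤ, L < m → ∀ a : ℤ, 0 ≤ a → leftT s L a b = rightT s L a b := by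
  induction b generalizing m with
  | zero => intro L hL a _; exact leftT_eq_rightT_zero hs hp m L hL a
  | succ b ihb =>
    induction m with
    | zero => intro L hL a _; rw [leftT_of_neg (by omega), rightT_of_neg (by omega)]
    | succ m ih =>
      intro L hL a ha
      have e1 := leftT_raise hs hp ha (Int.natCast_nonneg b) L
      have e2 := rightT_raise hs hp ha (Int.natCast_nonneg b) L
      push_cast at ih ⊢
      rw [ih (L - 1) (by omega) (a + 1) (by omega), ihb (m + 1) L hL (a + 1) (by omega),
        ihb (m + 1) (L - 1) (by omega) a ha] at e1
      linear_combination e1 - e2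

/-- The transformation from `𝒯` to `𝒯`. -/
theorem sum_gauss_mul_refinedT (hs : s ≠ 0) (hp : Generic (s ^ 2)) {a b : ℤ} (ha : 0 ≤ a)
    (hb : 0 ≤ b) (L : ℤ) (M : ℕ) :
    ∑ i ∈ Finset.range (M + 1),
        gauss (s ^ 2) L (M - i) * (s ^ ((i : ℤ) ^ 2) * refinedT s (L - i) i a b) =
      s ^ (b ^ 2) * refinedT s L M (a + b) b := by
  lift b to ℕ using hb
  have h := congrArg (coeff M)
    (leftT_eq_rightT_aux hs hp b (L.toNat + 1) L (by push_cast; omega) a ha)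
  rw [leftT, coeff_kern_mul_tau, rightT, coeff_tau] at h
  exact h

/-! ### The transformation from `𝒯` to `𝒮` -/

/-- The summand of the transformation from `𝒯` to `𝒮`. -/
def summandS (s : ℂ) (L a b i : ℤ) : ℂ := s ^ (i ^ 2) * refinedT s i (L - i) a b

theorem vanishesNeg_summandS (L a b : ℤ) : VanishesNeg (summandS s L a b) := fun i hi => by
  rw [summandS, refinedT_of_neg hi, mul_zero]

theorem tau_summandS_of_neg {L : ℤ} (hL : L < 0) (a b : ℤ) : tau (summandS s L a b) = 0 :=
  tau_eq_zero fun n hn => by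
    have : L - n < |b| := by have := abs_nonneg b; omega
    rw [summandS, refinedT_of_lt this, mul_zero]

/-- The generating function of the left-hand sides. -/
def leftS (s : ℂ) (L a b : ℤ) : PowerSeries ℂ := kern (s ^ 2) L * tau (summandS s L a b)

theorem leftS_of_neg {L : ℤ} (hL : L < 0) (a b : ℤ) : leftS s L a b = 0 := by
  rw [leftS, tau_summandS_of_neg hL, mul_zero]

theorem summandS_raise (hs : s ≠ 0) (hp : Generic (s ^ 2)) {a b : ℤ} (ha : 0 ≤ a) (hb : 0 ≤ b)
    (L : ℤ) :
    C (s ^ (2 * a + 1)) * tau (summandS s L a (b + 1)) + C (s ^ (2 * a + 2)) *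
        ((1 - X) * rescale (s ^ 2) (tau (summandS s (L - 1) (a + 1) (b + 1)))) =
      tau (summandS s L (a + 1) b) +
        C s * ((1 - X) * rescale (s ^ 2) (tau (summandS s (L - 1) a b))) := by
  simp only [rescale_tau, sub_mul, one_mul, mul_sub,
    X_mul_tau ((vanishesNeg_summandS _ _ _).dilate _), C_mul_tau, tau_sub, tau_add]
  refine tau_congr fun n _ => ?_
  have key := refinedT_raise_right hs hp ha hb n (L - n)
  simp only [summandS, dilate, sq_zpow_eq]
  rw [show L - 1 - (n - 1) = L - n by ring, show L - 1 - n = L - n - 1 by ring]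
  have z0 : s ^ (n - 1) ^ 2 = s ^ n ^ 2 * ((s ^ (2 * n))⁻¹ * s) := by
    rw [← zpow_neg, ← zpow_add_one₀ hs, ← zpow_add₀ hs]; congr 1; ring
  have z1 : s ^ (2 * (n - 1)) = s ^ (2 * n) * (s ^ 2)⁻¹ := by
    rw [← zpow_natCast s 2, ← zpow_neg, ← zpow_add₀ hs]; congr 1; push_cast; ring
  have z3 : s ^ (2 * (a + 1 + n)) = s ^ (2 * a) * s ^ 2 * s ^ (2 * n) := by
    rw [← zpow_natCast s 2, ← zpow_add₀ hs, ← zpow_add₀ hs]; congr 1; push_cast; ring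
  have z4 : s ^ (2 * a + 2) = s ^ (2 * a) * s ^ 2 := by
    rw [← zpow_natCast s 2, ← zpow_add₀ hs]; rfl
  rw [zpow_add_one₀ hs, zpow_add_one₀ hs, z3] at key
  rw [z0, z1, z4, zpow_add_one₀ hs]
  have n1 := zpow_ne_zero (2 * n) hs
  field_simp at key ⊢
  linear_combination key

theorem leftS_raise (hs : s ≠ 0) (hp : Generic (s ^ 2)) {a b : ℤ} (ha : 0 ≤ a) (hb : 0 ≤ b)
    (L : ℤ) :
    C (s ^ (2 * a + 1)) * leftS s L a (b + 1) +
        C (s ^ (2 * a + 2)) * rescale (s ^ 2) (leftS s (L - 1) (a + 1) (b + 1)) =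
      leftS s L (a + 1) b + C s * rescale (s ^ 2) (leftS s (L - 1) a b) := by
  have h : ∀ a b, L ≠ 0 ∨ tau (summandS s (L - 1) a b) = 0 := fun a b => by
    by_cases hL : L = 0
    · exact Or.inr (tau_summandS_of_neg (by omega) a b)
    · exact Or.inl hL
  simp only [leftS]
  rw [rescale_kern_mul hp (h _ _), rescale_kern_mul hp (h _ _)]
  linear_combination kern (s ^ 2) L * summandS_raise hs hp ha hb L

/-- This is the 𝒯 recurrence at `k = n`, `M = L - n`. The terms with `L - 2` combine into 1 -
s^(2L-2) X, which turns the kernel for L - 1 into that for L - 2. -/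
theorem summandS_recurrence (hs : s ≠ 0) (hp : Generic (s ^ 2)) {L : ℤ} (hL : L ≠ 0) (a : ℤ) :
    tau (summandS s L a 0) - C (s ^ (2 * L - 1)) * (X * tau (summandS s (L - 1) (a + 1) 0) +
        X * tau (summandS s (L - 1) (a - 1) 0)) =
      tau (summandS s (L - 1) a 0) + C (s ^ (2 * L - 2)) *
        (X * tau (summandS s (L - 2) a 0)
          - C (s ^ (2 * L - 2)) * (X * (X * tau (summandS s (L - 2) a 0)))) := by
  have hv : VanishesNeg fun n => summandS s (L - 2) a 0 (n - 1) := fun n hn =>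
    vanishesNeg_summandS _ _ _ _ (by omega)
  simp only [X_mul_tau (vanishesNeg_summandS _ _ _), X_mul_tau hv, C_mul_tau, tau_sub, tau_add]
  refine tau_congr fun n _ => ?_
  simp only [summandS]
  rw [show L - 1 - (n - 1) = L - n by ring, show L - 2 - (n - 1) = L - n - 1 by ring,
    show L - 1 - n = L - n - 1 by ring, show L - 2 - (n - 1 - 1) = L - n by ring,
    show n - 1 - 1 = n - 2 by ring]
  have z0 : s ^ (2 * L - 1) * s ^ (n - 1) ^ 2 = s ^ n ^ 2 * s ^ (2 * (L - n)) := by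
    rw [← zpow_add₀ hs, ← zpow_add₀ hs]; congr 1; ring
  have z1 : s ^ (2 * L - 2) * s ^ (n - 1) ^ 2 = s ^ n ^ 2 * s ^ (2 * (L - n) - 1) := by
    rw [← zpow_add₀ hs, ← zpow_add₀ hs]; congr 1; ring
  have z2 : s ^ (2 * L - 2) * (s ^ (2 * L - 2) * s ^ (n - 2) ^ 2) =
      s ^ n ^ 2 * s ^ (4 * (L - n)) := by
    rw [← zpow_add₀ hs, ← zpow_add₀ hs, ← zpow_add₀ hs]; congr 1; ring
  have key : refinedT s n (L - n) a 0 - s ^ (2 * (L - n)) * refinedT s (n - 1) (L - n) (a + 1) 0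
      - s ^ (2 * (L - n)) * refinedT s (n - 1) (L - n) (a - 1) 0
      + s ^ (4 * (L - n)) * refinedT s (n - 2) (L - n) a 0 =
    refinedT s n (L - n - 1) a 0
      + s ^ (2 * (L - n) - 1) * refinedT s (n - 1) (L - n - 1) a 0 := by
    by_cases hn : L - n = 0
    · have h0 : ∀ k a, refinedT s k (0 - 1) a 0 = 0 :=
        fun k a => refinedT_of_lt (by norm_num) k a
      rw [hn]
      simp only [h0, mul_zero, zpow_zero, one_mul, add_zero]
      exact refinedT_recurrence_zero hp (by omega) a
    · exact refinedT_recurrence hs hp hn n a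
  linear_combination s ^ n ^ 2 * key
    - (refinedT s (n - 1) (L - n) (a + 1) 0 + refinedT s (n - 1) (L - n) (a - 1) 0) * z0
    - refinedT s (n - 1) (L - n - 1) a 0 * z1 + refinedT s (n - 2) (L - n) a 0 * z2

theorem leftS_recurrence (hs : s ≠ 0) (hp : Generic (s ^ 2)) {L : ℤ} (hL : 0 < L) (a : ℤ) :
    (1 - C (s ^ (2 * L)) * X) * leftS s L a 0 - C (s ^ (2 * L - 1)) *
        (X * leftS s (L - 1) (a + 1) 0 + X * leftS s (L - 1) (a - 1) 0) =
      leftS s (L - 1) a 0 + C (s ^ (2 * L - 2)) * (X * leftS s (L - 2) a 0) := by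
  have h : kern (s ^ 2) (L - 2) * tau (summandS s (L - 2) a 0) =
      (1 - C (s ^ (2 * L - 2)) * X) * kern (s ^ 2) (L - 1) * tau (summandS s (L - 2) a 0) := by
    by_cases hL' : L = 1
    · rw [tau_summandS_of_neg (by omega)]; simp
    · rw [show L - 2 = L - 1 - 1 by ring, kern_sub_one hp (by omega : L - 1 ≠ 0), sq_zpow_eq,
        mul_sub_one]
  have h2 := kern_sub_one hp hL.ne'
  rw [sq_zpow_eq] at h2
  simp only [leftS]
  rw [h]
  linear_combination kern (s ^ 2) (L - 1) * summandS_recurrence hs hp hL.ne' a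
    - tau (summandS s L a 0) * h2

/-- The generating function of the right-hand sides at `b = 0`. -/
def rightS (s : ℂ) (L a : ℤ) : PowerSeries ℂ := tau fun M => kap s M 0 L a

theorem kap_of_neg {L : ℤ} (hL : L < 0) (M b c : ℤ) : kap s M b L c = 0 :=
  tripleConv_of_neg (vanishesNeg_gauss _ _) (vanishesNeg_ebin _ _) (vanishesNeg_ebin _ _) hL c

theorem kap_zero_of_ne {c : ℤ} (hc : c ≠ 0) (M b : ℤ) : kap s M b 0 c = 0 :=
  tripleConv_zero (vanishesNeg_gauss _ _) (vanishesNeg_ebin _ _) (vanishesNeg_ebin _ _) hc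

theorem kap_zero_zero (hp : Generic (s ^ 2)) {M : ℤ} (hM : 0 ≤ M) : kap s M 0 0 0 = 1 := by
  rw [kap, tripleConv_zero_zero (vanishesNeg_gauss _ _) (vanishesNeg_ebin _ _), ebin, ebin,
    qBinom_eq_gauss, qBinom_eq_gauss]
  simp [gauss_zero_right hp hM]

theorem kap_zero_left (hp : Generic (s ^ 2)) {L : ℤ} (hL : 0 ≤ L) (c : ℤ) :
    kap s 0 0 L c = delta c := by
  rw [kap, tripleConv, finsum_eq_single _ 0]
  · by_cases hc : c = 0
    · subst hc; simp [ebin_zero, gauss_zero_left hp hL, delta]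
    · simp [ebin_zero, delta, hc]
  · intro A hA
    simp [ebin_zero, delta, hA]

theorem rightS_recurrence (hs : s ≠ 0) (hp : Generic (s ^ 2)) {L : ℤ} (hL : 0 < L) (a : ℤ) :
    (1 - C (s ^ (2 * L)) * X) * rightS s L a - C (s ^ (2 * L - 1)) *
        (X * rightS s (L - 1) (a + 1) + X * rightS s (L - 1) (a - 1)) =
      rightS s (L - 1) a + C (s ^ (2 * L - 2)) * (X * rightS s (L - 2) a) := by
  have h0 : ∀ {M : ℤ}, M < 0 → ∀ L a, kap s M 0 L a = 0 := fun hM L a =>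
    tripleConv_eq_zero fun A => by rw [gauss_of_left_neg hM, zero_mul, zero_mul]
  have hv : ∀ L a, VanishesNeg fun M => kap s M 0 L a := fun L a M hM => h0 hM L a
  simp only [rightS, sub_mul, one_mul, mul_assoc, X_mul_tau (hv _ _), C_mul_tau, tau_sub, tau_add]
  refine tau_congr fun n _ => ?_
  by_cases hn : n = 0
  · subst hn
    simp only [h0 (show (0 : ℤ) - 1 < 0 by norm_num)]
    rw [kap_zero_left hp hL.le, kap_zero_left hp (by omega)]
    ring
  · linear_combination kap_recurrence hs hp hn L a

theorem leftS_zero_left (hp : Generic (s ^ 2)) (a : ℤ) : leftS s 0 a 0 = rightS s 0 a := by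
  have h1 : tau (summandS s 0 a 0) = C (refinedT s 0 0 a 0) := by
    ext n
    rw [coeff_tau, coeff_C, summandS]
    split_ifs with h
    · simp [h]
    · have h2 : 0 - (n : ℤ) < |0| := by rw [abs_zero]; omega
      rw [refinedT_of_lt h2, mul_zero]
  rw [leftS, h1, rightS]
  ext n
  rw [coeff_mul_C, kern_zero hp, coeff_tau]
  by_cases ha : a = 0
  · subst ha
    rw [refinedT_zero_zero hp le_rfl, kap_zero_zero hp (by omega)]; simp
  · rw [refinedT_zero ha, kap_zero_of_ne ha]; simp

theorem leftS_eq_rightS (hs : s ≠ 0) (hp : Generic (s ^ 2)) (m : ℕ) :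
    ∀ L : ℤ, L < m → ∀ a : ℤ, leftS s L a 0 = rightS s L a := by
  induction m with
  | zero =>
    intro L hL a
    rw [leftS_of_neg (by omega), rightS, tau_eq_zero fun n _ => kap_of_neg (by omega) _ _ _]
  | succ m ih =>
    intro L hL a
    rcases lt_trichotomy L 0 with h | rfl | h
    · rw [leftS_of_neg h, rightS, tau_eq_zero fun n _ => kap_of_neg h _ _ _]
    · exact leftS_zero_left hp a
    · have e1 := leftS_recurrence hs hp h a
      have e2 := rightS_recurrence hs hp h a
      simp only [ih (L - 1) (by omega), ih (L - 2) (by omega)] at e1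
      refine mul_left_cancel₀ (one_sub_C_mul_X_ne_zero (s ^ (2 * L))) ?_
      linear_combination e1 - e2

/-- `kap_raise` fails at M = b, so the induction runs on single coefficients with b ≤ M. This is
possible because `leftS_raise` involves only rescaling and does not mix powers of X. -/
theorem coeff_leftS (hs : s ≠ 0) (hp : Generic (s ^ 2)) (b m : ℕ) :
    ∀ L : ℤ, L < m → ∀ a : ℤ, 0 ≤ a → ∀ M : ℕ, b ≤ M →
      s ^ ((b : ℤ) ^ 2 + 2 * a * b) * coeff M (leftS s L a b) = kap s M b L (a + b) := by
  induction b generalizing m with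
  | zero =>
    intro L hL a _ M _
    rw [Nat.cast_zero, leftS_eq_rightS hs hp m L hL a, rightS, coeff_tau]
    simp
  | succ b ihb =>
    induction m with
    | zero =>
      intro L hL a _ M _
      rw [leftS_of_neg (by omega), kap_of_neg (by omega), map_zero, mul_zero]
    | succ m ih =>
      intro L hL a ha M hM
      have e1 := congrArg (coeff M) (leftS_raise hs hp ha (Int.natCast_nonneg b) L)
      simp only [map_add, coeff_C_mul, coeff_rescale] at e1
      have e2 := kap_raise hs hp (M := M) (b := b) (by omega) (by omega) L (a + b + 1)
      have i1 := ih (L - 1) (by omega) (a + 1) (by omega) M hM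
      have i2 := ihb (m + 1) L hL (a + 1) (by omega) M (by omega)
      have i3 := ihb (m + 1) (L - 1) (by omega) a ha M (by omega)
      push_cast at i1 ⊢
      rw [show a + 1 + ((b : ℤ) + 1) = a + b + 1 + 1 by ring] at i1
      rw [show a + 1 + (b : ℤ) = a + b + 1 by ring] at i2
      rw [add_sub_cancel_right, ← i1, ← i2, ← i3] at e2
      rw [show a + ((b : ℤ) + 1) = a + b + 1 by ring]
      have z1 : s ^ (2 * ((M : ℤ) - b) - 1) * s ^ (((b : ℤ) + 1) ^ 2 + 2 * (a + 1) * (b + 1)) =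
          s ^ ((b : ℤ) ^ 2 + 2 * (a + 1) * b) * s ^ (2 * a + 2) * (s ^ 2) ^ M := by
        rw [← pow_mul, ← zpow_natCast s (2 * M), ← zpow_add₀ hs, ← zpow_add₀ hs, ← zpow_add₀ hs]
        congr 1; push_cast; ring
      have z2 : s ^ (2 * ((M : ℤ) + b) + 1) * s ^ ((b : ℤ) ^ 2 + 2 * a * b) =
          s ^ ((b : ℤ) ^ 2 + 2 * (a + 1) * b) * s * (s ^ 2) ^ M := by
        rw [← pow_mul, ← zpow_natCast s (2 * M), ← zpow_add_one₀ hs, ← zpow_add₀ hs,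
          ← zpow_add₀ hs]
        congr 1; push_cast; ring
      have z3 : s ^ (((b : ℤ) + 1) ^ 2 + 2 * a * (b + 1)) =
          s ^ ((b : ℤ) ^ 2 + 2 * (a + 1) * b) * s ^ (2 * a + 1) := by
        rw [← zpow_add₀ hs]; congr 1; ring
      rw [z3]
      linear_combination s ^ ((b : ℤ) ^ 2 + 2 * (a + 1) * b) * e1 - e2
        + coeff M (leftS s (L - 1) (a + 1) (b + 1)) * z1 - coeff M (leftS s (L - 1) a b) * z2

theorem refinedS_of_lt {L M a b : ℤ} (h : M < |a - b|) (q : ℂ) : refinedS L M a b q = 0 := by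
  rw [refinedS, ← finsum_zero (α := ℕ)]
  refine finsum_congr fun n => ?_
  rw [refinedSTerm, qBinom_eq_gauss q (M - a + b), qBinom_eq_gauss q (M + a - b)]
  by_cases h1 : M - a + b - n < 0
  · rw [gauss_of_left_neg h1, mul_zero, zero_mul]
  by_cases h2 : (n : ℤ) + a < 0
  · rw [gauss_of_right_neg _ h2, mul_zero]
  · have h3 : M + a - b - (n + a) < 0 := by rcases lt_abs.1 h with h | h <;> omega
    rw [gauss_of_left_neg h3, mul_zero]

/-- The transformation from `𝒯` to `𝒮`. -/
theorem sum_gauss_mul_refinedT_eq_refinedS (hs : s ≠ 0) (hp : Generic (s ^ 2)) {a b : ℤ}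
    (hab : b ≤ a) (hb : 0 ≤ b) (L : ℤ) (M : ℕ) :
    ∑ i ∈ Finset.range (M + 1),
        gauss (s ^ 2) L (M - i) * (s ^ ((i : ℤ) ^ 2) * refinedT s i (L - i) a b) =
      s ^ (a ^ 2) * refinedS L M (a + b) a (s ^ 2) := by
  lift b to ℕ using hb
  by_cases hM : b ≤ M
  · have h := coeff_leftS hs hp b (L.toNat + 1) L (by push_cast; omega) a (by omega) M hM
    have h2 := refinedS_eq_kap hs L M (a + b) a
    rw [add_sub_cancel_left, ← h, leftS, coeff_kern_mul_tau] at h2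
    have z : s ^ (a + b) ^ 2 = s ^ ((b : ℤ) ^ 2 + 2 * a * b) * s ^ a ^ 2 := by
      rw [← zpow_add₀ hs]; congr 1; ring
    rw [z, mul_assoc] at h2
    exact (mul_left_cancel₀ (zpow_ne_zero _ hs) h2).symm
  · rw [refinedS_of_lt (by rw [add_sub_cancel_left, abs_of_nonneg (by omega)]; omega), mul_zero]
    refine Finset.sum_eq_zero fun i hi => ?_
    rw [Finset.mem_range] at hi
    -- Here i ≤ M < b ≤ a, so 𝒯 is asked for a power of z beyond the degree in x.
    rw [refinedT_of_lt_abs (by rw [abs_of_nonneg (by omega)]; omega), mul_zero, mul_zero]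

/-! ### The `q`-Pfaff–Saalschütz sum -/

theorem gauss_trinomial_revision {p : ℂ} (hp : Generic p) (N : ℕ) (j A : ℤ) :
    gauss p (N - j) (A + j) * gauss p j A = qBinom p N j * gauss p N A := by
  rw [qBinom_eq_gauss]
  rcases lt_or_ge j 0 with hj | hj
  · rw [gauss_of_left_neg hj, gauss_of_right_neg _ hj]; ring
  rcases lt_or_ge A 0 with hA | hA
  · rw [gauss_of_right_neg _ hA, gauss_of_right_neg _ hA]; ring
  rcases lt_or_ge ((N : ℤ) - j) 0 with hN | hN
  · rw [gauss_of_left_neg hN, gauss_of_left_neg hN]; ring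
  lift j to ℕ using hj
  lift A to ℕ using hA
  obtain ⟨t, rfl⟩ : ∃ t : ℕ, N = t + j := ⟨N - j, by omega⟩
  have e1 : ((t + j : ℕ) : ℤ) - j = t := by push_cast; ring
  have e2 : (A : ℤ) + j = (A + j : ℕ) := by push_cast; ring
  rw [e1, e2]
  simp only [gauss_natCast]
  rw [show t + (A + j) = t + j + A by ring, add_comm j A]
  have n1 := hp.qPoch_ne_zero
  have := n1 (A + j); have := n1 t; have := n1 A; have := n1 j; have := n1 (t + j)
  field_simp

/-- The summand of the `q`-Pfaff–Saalschütz sum. -/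
def saalTerm (p : ℂ) (M N j A n : ℤ) : ℂ :=
  p ^ (n * (n + j)) * qBinom p M n * qBinom p N (n + j) * gauss p (M + N) (A - n)

theorem qBinom_of_lt (p : ℂ) {N n : ℤ} (h : N < n) : qBinom p N n = 0 := by
  rw [qBinom, if_neg (by omega)]

theorem qBinom_of_neg (p : ℂ) {N n : ℤ} (h : n < 0) : qBinom p N n = 0 := by
  rw [qBinom, if_neg (by omega)]

theorem saalTerm_succ {p : ℂ} (hp : Generic p) (M N : ℕ) (j A n : ℤ) :
    saalTerm p (M + 1) N j A n - p ^ ((M : ℤ) + N + 1) * saalTerm p (M + 1) N j (A - 1) n =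
      saalTerm p M N j A n + p ^ ((M : ℤ) + 1 + j) * saalTerm p M N (j + 1) (A - 1) (n - 1) := by
  have hp0 := hp.ne_zero
  simp only [saalTerm]
  have e1 := gauss_pascal hp (P := (M : ℤ) + N + 1) (A := A - n) (Or.inl (by omega))
  have e2 := gauss_pascal hp (P := (M : ℤ) + 1 - n) (A := n) (by omega)
  rw [add_sub_cancel_right] at e1
  simp only [qBinom_eq_gauss p ((M : ℤ) + 1), qBinom_eq_gauss p (M : ℤ)]
  rw [show (M : ℤ) + 1 + N = M + N + 1 by ring, show A - 1 - n = A - n - 1 by ring,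
    show A - 1 - (n - 1) = A - n by ring, show (M : ℤ) - (n - 1) = M + 1 - n by ring,
    show n - 1 + (j + 1) = n + j by ring, show (M : ℤ) - n = M + 1 - n - 1 by ring, e1, e2]
  have z : p ^ ((M : ℤ) + 1 + j) * p ^ ((n - 1) * (n + j)) =
      p ^ (n * (n + j)) * p ^ ((M : ℤ) + 1 - n) := by
    rw [← zpow_add₀ hp0, ← zpow_add₀ hp0]; congr 1; ring
  linear_combination -gauss p ((M : ℤ) + 1 - n) (n - 1) * qBinom p N (n + j) *
    gauss p (M + N) (A - n) * z

theorem saal_product_succ {p : ℂ} (hp : Generic p) (M N : ℕ) (j A : ℤ) :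
    gauss p (N - j) (A + j) * gauss p (M + 1 + j) A
        - p ^ ((M : ℤ) + N + 1) * (gauss p (N - j) (A - 1 + j) * gauss p (M + 1 + j) (A - 1)) =
      gauss p (N - j) (A + j) * gauss p (M + j) A + p ^ ((M : ℤ) + 1 + j) *
        (gauss p (N - (j + 1)) (A - 1 + (j + 1)) * gauss p (M + (j + 1)) (A - 1)) := by
  have e1 : gauss p (N - j) (A + j) * gauss p (M + 1 + j) A = gauss p (N - j) (A + j) *
      (gauss p (M + j) A + p ^ ((M : ℤ) + 1 + j) * gauss p (M + 1 + j) (A - 1)) := by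
    -- In the one case without Pascal's rule, A + j is negative and the other factor vanishes.
    by_cases h : (M : ℤ) + 1 + j = 0 ∧ A = 0
    · rw [gauss_of_right_neg (A := A + j) _ (by omega), zero_mul, zero_mul]
    · rw [gauss_pascal hp (P := (M : ℤ) + 1 + j) (A := A) (by omega),
        show (M : ℤ) + 1 + j - 1 = M + j by ring]
  have e2 : gauss p (N - j) (A + j) * gauss p (M + 1 + j) (A - 1) =
      (gauss p (N - (j + 1)) (A + j) + p ^ ((N : ℤ) - j) * gauss p (N - j) (A - 1 + j)) *
        gauss p (M + 1 + j) (A - 1) := by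
    by_cases h : (N : ℤ) - j = 0 ∧ A + j = 0
    · rw [gauss_of_right_neg (A := A - 1) _ (by omega), mul_zero, mul_zero]
    · rw [gauss_pascal hp (P := (N : ℤ) - j) (A := A + j) (by omega),
        show (N : ℤ) - j - 1 = N - (j + 1) by ring, show A + j - 1 = A - 1 + j by ring]
  have z : p ^ ((M : ℤ) + N + 1) = p ^ ((M : ℤ) + 1 + j) * p ^ ((N : ℤ) - j) := by
    rw [← zpow_add₀ hp.ne_zero]; congr 1; ring
  rw [show A - 1 + (j + 1) = A + j by ring, show (M : ℤ) + (j + 1) = M + 1 + j by ring, z]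
  linear_combination e1 + p ^ ((M : ℤ) + 1 + j) * e2

/-- The `q`-Pfaff–Saalschütz sum. -/
theorem gauss_mul_gauss {p : ℂ} (hp : Generic p) (N M : ℕ) :
    ∀ K : ℕ, M < K → ∀ j A : ℤ, gauss p (N - j) (A + j) * gauss p (M + j) A =
      ∑ n ∈ Finset.range K, saalTerm p M N j A n := by
  induction M with
  | zero =>
    intro K hK j A
    rw [Finset.sum_eq_single_of_mem 0 (Finset.mem_range.2 hK)]
    · have := gauss_trinomial_revision hp N j A
      simpa [saalTerm, qBinom, qPoch_zero] using this
    · intro n _ hn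
      rw [saalTerm, qBinom_of_lt p (by omega)]; ring
  | succ M ih =>
    intro K hK j A
    obtain ⟨K, rfl⟩ : ∃ K', K = K' + 1 := ⟨K - 1, by omega⟩
    -- Both sides satisfy the same recurrence, which leads from M + 1 to M and from A to A - 1; both
    -- vanish for A < 0.
    have main : ∀ m : ℕ, ∀ A : ℤ, A < m → gauss p (N - j) (A + j) * gauss p (M + 1 + j) A =
        ∑ n ∈ Finset.range (K + 1), saalTerm p (M + 1) N j A n := by
      intro m
      induction m with
      | zero =>
        intro A hA
        rw [gauss_of_right_neg (A := A) _ (by omega), mul_zero, Finset.sum_eq_zero]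
        intro n _
        rw [saalTerm, gauss_of_right_neg _ (by omega), mul_zero]
      | succ m ihm =>
        intro A hA
        have h1 := Finset.sum_congr rfl
          fun (n : ℕ) (_ : n ∈ Finset.range (K + 1)) => saalTerm_succ hp M N j A n
        rw [Finset.sum_sub_distrib, Finset.sum_add_distrib, ← Finset.mul_sum, ← Finset.mul_sum,
          ← ihm (A - 1) (by omega), ← ih (K + 1) (by omega),
          Finset.sum_range_succ' (fun n : ℕ => saalTerm p M N (j + 1) (A - 1) (n - 1))] at h1
        have h2 : saalTerm p M N (j + 1) (A - 1) (((0 : ℕ) : ℤ) - 1) = 0 := by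
          rw [saalTerm, qBinom_of_neg p (by simp)]; ring
        rw [h2, add_zero] at h1
        simp only [Nat.cast_add, Nat.cast_one, add_sub_cancel_right] at h1
        rw [← ih K (by omega)] at h1
        linear_combination saal_product_succ hp M N j A - h1
    push_cast
    exact main (A.toNat + 1) A (by push_cast; omega)

/-! ### The cubic seed identity -/

theorem tripleConv_of_lt_abs {e f g : ℤ → ℂ} {k a : ℤ} (he : VanishesNeg e) (hf : VanishesNeg f)
    (hg : VanishesNeg g) (h : k < |a|) : tripleConv e f g k a = 0 := by
  refine tripleConv_eq_zero fun A => ?_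
  by_cases h1 : k - 2 * A - a < 0
  · rw [he _ h1, zero_mul, zero_mul]
  by_cases h2 : A < 0
  · rw [hf _ h2, mul_zero, zero_mul]
  have h3 : A + a < 0 := by
    rcases lt_abs.1 h with h | h <;> omega
  rw [hg _ h3, mul_zero]

/-- The triple convolution, summed over its second index with weight `w ^ j`. -/
def weightedConv (w : ℂ) (e f g : ℤ → ℂ) (m : ℤ) : ℂ := ∑ᶠ j : ℤ, w ^ j * tripleConv e f g m j

theorem weightedConv_finite (w : ℂ) {e f g : ℤ → ℂ} (he : VanishesNeg e) (hf : VanishesNeg f)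
    (hg : VanishesNeg g) (m : ℤ) :
    (Function.support fun j : ℤ => w ^ j * tripleConv e f g m j).Finite := by
  refine (Set.finite_Icc (-m) m).subset fun j hj => ?_
  by_contra h
  refine hj ?_
  have h' : m < |j| := by
    rw [← not_le, abs_le]; exact h
  simp only [tripleConv_of_lt_abs he hf hg h', mul_zero]

theorem weightedConv_left {w c : ℂ} {e e₁ e₂ f g : ℤ → ℂ} (h₁ : VanishesNeg e₁)
    (h₂ : VanishesNeg e₂) (hf : VanishesNeg f) (hg : VanishesNeg g)
    (h : ∀ n, e n = e₁ n + c * e₂ (n - 1)) (m : ℤ) :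
    weightedConv w e f g m = weightedConv w e₁ f g m + c * weightedConv w e₂ f g (m - 1) := by
  unfold weightedConv
  rw [← finsum_add_const_mul (weightedConv_finite w h₁ hf hg m)
    (weightedConv_finite w h₂ hf hg (m - 1))]
  refine finsum_congr fun j => ?_
  rw [tripleConv_left h₁ h₂ hf h]; ring

theorem weightedConv_mid {w c : ℂ} (hw : w ≠ 0) {e f f₁ f₂ g : ℤ → ℂ} (he : VanishesNeg e)
    (h₁ : VanishesNeg f₁) (h₂ : VanishesNeg f₂) (hg : VanishesNeg g)
    (h : ∀ n, f n = f₁ n + c * f₂ (n - 1)) (m : ℤ) :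
    weightedConv w e f g m =
      weightedConv w e f₁ g m + c * w⁻¹ * weightedConv w e f₂ g (m - 1) := by
  unfold weightedConv
  rw [← finsum_comp_equiv (Equiv.addRight (1 : ℤ))
    (f := fun j => w ^ j * tripleConv e f₂ g (m - 1) j),
    ← finsum_add_const_mul (weightedConv_finite w he h₁ hg m)
    ((weightedConv_finite w he h₂ hg (m - 1)).preimage (Equiv.addRight (1 : ℤ)).injective.injOn)]
  refine finsum_congr fun j => ?_
  simp only [Equiv.coe_addRight]
  rw [tripleConv_mid he h₁ h₂ h, zpow_add_one₀ hw]
  field_simp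

theorem weightedConv_right {w c : ℂ} (hw : w ≠ 0) {e f g g₁ g₂ : ℤ → ℂ} (he : VanishesNeg e)
    (hf : VanishesNeg f) (h₁ : VanishesNeg g₁) (h₂ : VanishesNeg g₂)
    (h : ∀ n, g n = g₁ n + c * g₂ (n - 1)) (m : ℤ) :
    weightedConv w e f g m =
      weightedConv w e f g₁ m + c * w * weightedConv w e f g₂ (m - 1) := by
  unfold weightedConv
  rw [← finsum_comp_equiv (Equiv.subRight (1 : ℤ))
    (f := fun j => w ^ j * tripleConv e f g₂ (m - 1) j),
    ← finsum_add_const_mul (weightedConv_finite w he hf h₁ m)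
    ((weightedConv_finite w he hf h₂ (m - 1)).preimage (Equiv.subRight (1 : ℤ)).injective.injOn)]
  refine finsum_congr fun j => ?_
  simp only [Equiv.subRight_apply]
  rw [tripleConv_right he hf (fun n _ => h n), zpow_sub_one₀ hw]
  field_simp

theorem weightedConv_delta (w : ℂ) (m : ℤ) : weightedConv w delta delta delta m = delta m := by
  have h : ∀ j, tripleConv delta delta delta m j = delta m * delta j := fun j => by
    rw [tripleConv, finsum_eq_single _ 0]
    · by_cases hj : j = 0
      · subst hj; simp [delta]
      · simp [delta, hj]
    · intro A hA
      rw [show delta A = 0 from if_neg hA, mul_zero, zero_mul]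
  rw [weightedConv, finsum_eq_single _ 0]
  · rw [h]; simp [delta]
  · intro j hj
    rw [h, show delta j = 0 from if_neg hj, mul_zero, mul_zero]

/-- The factorisation of `(-x q ^ (1 / 2); q)_{3 n}` over residue classes modulo `3`. -/
theorem weightedConv_ebin {r : ℂ} (hr : r ≠ 0) (hq : Generic (r ^ 2)) (hp : Generic ((r ^ 3) ^ 2))
    (n : ℕ) (m : ℤ) :
    weightedConv (r ^ 2) (ebin (r ^ 3) n) (ebin (r ^ 3) n) (ebin (r ^ 3) n) m =
      ebin r (3 * n) m := by
  have hs : r ^ 3 ≠ 0 := pow_ne_zero 3 hr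
  have hw : r ^ 2 ≠ 0 := pow_ne_zero 2 hr
  induction n generalizing m with
  | zero => rw [Nat.cast_zero, mul_zero, ebin_zero, ebin_zero, weightedConv_delta]
  | succ n ih =>
    have hn : (n : ℤ) + 1 ≠ 0 := by omega
    have v := vanishesNeg_ebin (r ^ 3)
    have st : ∀ x, ebin (r ^ 3) (n + 1) x =
        ebin (r ^ 3) n x + r ^ (6 * (n : ℤ) + 3) * ebin (r ^ 3) n (x - 1) := fun x => by
      rw [ebin_step hs hp hn, add_sub_cancel_right]
      congr 2
      rw [← zpow_natCast, ← zpow_mul]; congr 1; push_cast; ring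
    have e1 := weightedConv_left (w := r ^ 2) (v n) (v n) (v (n + 1)) (v (n + 1)) st
    have e2 := weightedConv_mid hw (v n) (v n) (v n) (v (n + 1)) st
    have e3 := weightedConv_right hw (v n) (v n) (v n) (v n) st
    push_cast
    simp only [e1, e2, e3, ih]
    have f1 := ebin_step hr hq (N := 3 * ((n : ℤ) + 1)) (by omega)
    have f2 := ebin_step hr hq (N := 3 * (n : ℤ) + 2) (by omega)
    have f3 := ebin_step hr hq (N := 3 * (n : ℤ) + 1) (by omega)
    rw [show 3 * ((n : ℤ) + 1) - 1 = 3 * n + 2 by ring] at f1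
    rw [show 3 * (n : ℤ) + 2 - 1 = 3 * n + 1 by ring] at f2
    rw [add_sub_cancel_right] at f3
    -- The three new factors of (-rx; r²)_(3n+3) have exponents 6n + 1, 6n + 3, 6n + 5. They are the
    -- new factors of the x/z, x and xz products at z = r².
    have z1 : r ^ (2 * (3 * ((n : ℤ) + 1)) - 1) = r ^ (6 * (n : ℤ) + 3) * r ^ 2 := by
      rw [← zpow_natCast r 2, ← zpow_add₀ hr]; congr 1; push_cast; ring
    have z2 : r ^ (2 * (3 * (n : ℤ) + 2) - 1) = r ^ (6 * (n : ℤ) + 3) := by congr 1; ring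
    have z3 : r ^ (2 * (3 * (n : ℤ) + 1) - 1) = r ^ (6 * (n : ℤ) + 3) * (r ^ 2)⁻¹ := by
      rw [← zpow_natCast r 2, ← zpow_neg, ← zpow_add₀ hr]; congr 1; push_cast; ring
    rw [f1, f2, f2]
    simp only [f3]
    rw [z1, z2, z3]
    ring

/-- For a = b = j, Saalschütz expands the product of the two denominator coefficients; the new top
entry 2n is free of j, so j can later be summed. -/
theorem refinedT_diag_eq_finsum (hs : s ≠ 0) (hp : Generic (s ^ 2)) (n : ℕ) (k j : ℤ) :
    s ^ (j ^ 2) * refinedT s k n j j = ∑ᶠ t : ℤ, gauss (s ^ 2) (2 * n) t *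
      tripleConv (ebin s n) (ebin s n) (ebin s n) (k - 2 * t) j := by
  have hsaal := gauss_mul_gauss hp n n (n + 1) (Nat.lt_succ_self n) j
  set F : ℕ → ℤ → ℂ := fun l t => gauss (s ^ 2) (2 * n) t *
    (ebin s n (k - 2 * t - 2 * l - j) * ebin s n l * ebin s n (l + j)) with hF
  have hfin : ∀ l : ℕ, (Function.support (F l)).Finite := fun l => by
    refine (Set.finite_Icc 0 (k - j)).subset fun t ht => ?_
    have h1 : ¬ t < 0 := fun h => ht (by simp only [hF, vanishesNeg_gauss _ _ _ h, zero_mul])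
    have h2 : ¬ k - 2 * t - 2 * l - j < 0 := fun h => ht (by
      simp only [hF, vanishesNeg_ebin _ _ _ h, zero_mul, mul_zero])
    exact ⟨by omega, by omega⟩
  have lhs : s ^ (j ^ 2) * refinedT s k n j j =
      ∑ᶠ A : ℤ, ∑ l ∈ Finset.range (n + 1), F l (A - l) := by
    rw [refinedT, tripleConv, mul_finsum]
    refine finsum_congr fun A => ?_
    rw [mul_assoc (ebin s n _), mul_comm (gauss (s ^ 2) (n + j) A), hsaal, Finset.mul_sum,
      Finset.mul_sum]
    refine Finset.sum_congr rfl fun l _ => ?_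
    simp only [hF, saalTerm]
    rw [show k - 2 * (A - l) - 2 * l - j = k - 2 * A - j by ring, ebin, ebin, ebin, sq_zpow_eq,
      show (n : ℤ) + n = 2 * n by ring]
    have z : s ^ (j ^ 2) * s ^ (2 * ((l : ℤ) * (l + j))) =
        s ^ ((l : ℤ) ^ 2) * s ^ (((l : ℤ) + j) ^ 2) := by
      rw [← zpow_add₀ hs, ← zpow_add₀ hs]; congr 1; ring
    linear_combination s ^ ((k - 2 * A - j) ^ 2) * qBinom (s ^ 2) n (k - 2 * A - j) *
      qBinom (s ^ 2) n l * qBinom (s ^ 2) n (l + j) * gauss (s ^ 2) (2 * n) (A - l) * z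
  have rhs : ∀ t, gauss (s ^ 2) (2 * n) t *
      tripleConv (ebin s n) (ebin s n) (ebin s n) (k - 2 * t) j =
      ∑ l ∈ Finset.range (n + 1), F l t := fun t => by
    rw [tripleConv, finsum_int_eq_finsum_nat, finsum_eq_sum_of_support_subset _
      (s := Finset.range (n + 1)), Finset.mul_sum]
    · intro l hl
      rw [Finset.coe_range, Set.mem_Iio]
      by_contra h
      exact hl (by simp only [ebin_of_lt s (show (n : ℤ) < l by omega), mul_zero, zero_mul])
    · intro l hl
      simp only [vanishesNeg_ebin _ _ _ hl, mul_zero, zero_mul]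
  rw [lhs, finsum_congr rhs, finsum_sum_comm, finsum_sum_comm]
  · refine Finset.sum_congr rfl fun l _ => ?_
    exact finsum_comp_equiv (Equiv.subRight (l : ℤ)) (f := F l)
  · exact fun l _ => hfin l
  · exact fun l _ => (hfin l).preimage (Equiv.subRight (l : ℤ)).injective.injOn

/-- The summand over `m` of the seed identity. -/
def seedTerm (r : ℂ) (k : ℤ) (n m : ℕ) : ℂ :=
  if Even (k - m) then ebin r (3 * n) m * qBinom ((r ^ 3) ^ 2) (2 * n + (k - m) / 2) (2 * n) else 0

/-- The cubic seed identity. -/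
theorem finsum_seedTerm (hr : r ≠ 0) (hq : Generic (r ^ 2)) (hp : Generic ((r ^ 3) ^ 2))
    (k : ℤ) (n : ℕ) :
    ∑ᶠ m : ℕ, seedTerm r k n m = ∑ j ∈ Finset.Icc (-n : ℤ) n,
      r ^ (3 * j ^ 2 + 2 * j) * refinedT (r ^ 3) k n j j := by
  have hs : r ^ 3 ≠ 0 := pow_ne_zero 3 hr
  have h1 : ∀ j : ℤ, r ^ (3 * j ^ 2 + 2 * j) * refinedT (r ^ 3) k n j j =
      ∑ᶠ t : ℤ, gauss ((r ^ 3) ^ 2) (2 * n) t * ((r ^ 2) ^ j * tripleConv (ebin (r ^ 3) n)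
        (ebin (r ^ 3) n) (ebin (r ^ 3) n) (k - 2 * t) j) := fun j => by
    have z : r ^ (3 * j ^ 2 + 2 * j) = (r ^ 2) ^ j * (r ^ 3) ^ (j ^ 2) := by
      rw [sq_zpow_eq, ← zpow_natCast r 3, ← zpow_mul, ← zpow_add₀ hr]; congr 1; push_cast; ring
    rw [z, mul_assoc, refinedT_diag_eq_finsum hs hp, mul_finsum]
    exact finsum_congr fun t => by ring
  have hv := vanishesNeg_ebin (r ^ 3) n
  have hbig : ∀ (k j : ℤ), (n : ℤ) < |j| →
      tripleConv (ebin (r ^ 3) n) (ebin (r ^ 3) n) (ebin (r ^ 3) n) k j = 0 := fun k j hj => by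
    refine tripleConv_eq_zero fun A => ?_
    by_cases h1 : A < 0
    · rw [hv _ h1, mul_zero, zero_mul]
    by_cases h2 : A + j < 0
    · rw [hv _ h2, mul_zero]
    rcases lt_abs.1 hj with h | h
    · rw [ebin_of_lt (n := A + j) _ (by omega), mul_zero]
    · rw [ebin_of_lt (n := A) _ (by omega), mul_zero, zero_mul]
  have h2 : ∀ t : ℤ, ∑ j ∈ Finset.Icc (-n : ℤ) n, gauss ((r ^ 3) ^ 2) (2 * n) t * ((r ^ 2) ^ j *
      tripleConv (ebin (r ^ 3) n) (ebin (r ^ 3) n) (ebin (r ^ 3) n) (k - 2 * t) j) =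
      gauss ((r ^ 3) ^ 2) (2 * n) t * ebin r (3 * n) (k - 2 * t) := fun t => by
    rw [← Finset.mul_sum, ← weightedConv_ebin hr hq hp, weightedConv,
      finsum_eq_sum_of_support_subset]
    intro j hj
    rw [Finset.coe_Icc]
    by_contra h
    have h' : (n : ℤ) < |j| := by
      rw [← not_le, abs_le]; exact h
    exact hj (by simp only [hbig _ _ h', mul_zero])
  rw [Finset.sum_congr rfl fun j _ => h1 j, ← finsum_sum_comm, finsum_congr h2]
  -- The parity condition says exactly that m = k - 2t for an integer t.
  · set G : ℤ → ℂ := fun m => if Even (k - m) then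
      ebin r (3 * n) m * qBinom ((r ^ 3) ^ 2) (2 * n + (k - m) / 2) (2 * n) else 0 with hG
    have hGv : VanishesNeg G := fun m hm => by
      simp only [hG, vanishesNeg_ebin _ _ _ hm, zero_mul, ite_self]
    have h3 := finsum_int_eq_finsum_nat hGv
    rw [show ∑ᶠ m : ℕ, seedTerm r k n m = ∑ᶠ m : ℕ, G m from rfl, ← h3,
      finsum_eq_finsum_comp (g := fun t : ℤ => k - 2 * t)]
    · refine finsum_congr fun t => ?_
      have e1 : k - (k - 2 * t) = 2 * t := by ring
      have e2 : (2 * t) / 2 = t := by omega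
      simp only [hG, e1, e2, even_two_mul, if_true]
      rw [gauss, qBinom_symm _ _ t, add_sub_cancel_right, mul_comm]
    · intro a b hab
      simp only at hab
      omega
    · intro m hm
      simp only [hG]
      rw [if_neg]
      rintro ⟨t, ht⟩
      exact hm ⟨t, by simp only; omega⟩
  · intro j _
    refine (Set.finite_Icc 0 k).subset fun t ht => ?_
    have h1 : ¬ t < 0 := fun h => ht (by
      simp only [vanishesNeg_gauss _ _ _ h, zero_mul])
    have h2 : ¬ k - 2 * t < 0 := fun h => ht (by
      simp only [tripleConv_of_neg hv hv hv h, mul_zero])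
    exact ⟨by omega, by omega⟩

/-! ### Iteration -/

/-- The sums that arise from the seed by iterating the transformation from `𝒯` to `𝒯`. -/
def iterSum (r : ℂ) (c : ℕ) (k : ℤ) (M : ℕ) : ℂ :=
  ∑ j ∈ Finset.Icc (-M : ℤ) M,
    r ^ (3 * (c + 1) * j ^ 2 + 2 * j) * refinedT (r ^ 3) k M ((c + 1) * j) j

theorem iterSum_eq_sum {c : ℕ} {k : ℤ} {M K : ℕ} (h : M ≤ K) :
    iterSum r c k M = ∑ j ∈ Finset.Icc (-K : ℤ) K,
      r ^ (3 * (c + 1) * j ^ 2 + 2 * j) * refinedT (r ^ 3) k M ((c + 1) * j) j := by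
  refine Finset.sum_subset (Finset.Icc_subset_Icc (by omega) (by omega)) fun j _ hj => ?_
  have h' : (M : ℤ) < |j| := by
    rw [← not_le, abs_le]; simpa using hj
  rw [refinedT_of_lt h', mul_zero]

theorem sum_gauss_mul_refinedT_mul (hs : s ≠ 0) (hp : Generic (s ^ 2)) (c : ℕ) (j L : ℤ) (M : ℕ) :
    ∑ i ∈ Finset.range (M + 1),
        gauss (s ^ 2) L (M - i) * (s ^ ((i : ℤ) ^ 2) * refinedT s (L - i) i (c * j) j) =
      s ^ (j ^ 2) * refinedT s L M ((c + 1) * j) j := by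
  rcases le_total 0 j with hj | hj
  · rw [sum_gauss_mul_refinedT hs hp (by positivity) hj, add_one_mul]
  · have h := sum_gauss_mul_refinedT hs hp (a := c * (-j)) (b := -j)
      (mul_nonneg (Int.natCast_nonneg c) (by omega)) (by omega) L M
    rw [show (c : ℤ) * -j + -j = -((c + 1) * j) by ring, mul_neg] at h
    simpa only [refinedT_neg_neg, neg_sq] using h

theorem iterSum_succ (hr : r ≠ 0) (hp : Generic ((r ^ 3) ^ 2)) (c : ℕ) (k : ℤ) (M : ℕ) :
    ∑ N ∈ Finset.range (M + 1), gauss ((r ^ 3) ^ 2) k (M - N) *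
      ((r ^ 3) ^ ((N : ℤ) ^ 2) * iterSum r c (k - N) N) = iterSum r (c + 1) k M := by
  have h1 : ∀ N ∈ Finset.range (M + 1), gauss ((r ^ 3) ^ 2) k (M - N) *
      ((r ^ 3) ^ ((N : ℤ) ^ 2) * iterSum r c (k - N) N) =
      ∑ j ∈ Finset.Icc (-M : ℤ) M, r ^ (3 * (c + 1) * j ^ 2 + 2 * j) *
        (gauss ((r ^ 3) ^ 2) k (M - N) * ((r ^ 3) ^ ((N : ℤ) ^ 2) *
          refinedT (r ^ 3) (k - N) N ((c + 1 : ℕ) * j) j)) := fun N hN => by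
    rw [iterSum_eq_sum (K := M) (by simpa [Nat.lt_succ_iff] using hN), Finset.mul_sum,
      Finset.mul_sum]
    refine Finset.sum_congr rfl fun j _ => ?_
    push_cast
    ring
  rw [Finset.sum_congr rfl h1, Finset.sum_comm]
  refine Finset.sum_congr rfl fun j _ => ?_
  rw [← Finset.mul_sum, sum_gauss_mul_refinedT_mul (pow_ne_zero 3 hr) hp, ← mul_assoc]
  congr 1
  rw [← zpow_natCast r 3, ← zpow_mul, ← zpow_add₀ hr]; congr 1; push_cast; ring

theorem refinedS_neg_neg (hs : s ≠ 0) (L M a b : ℤ) :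
    refinedS L M (-a) (-b) (s ^ 2) = refinedS L M a b (s ^ 2) := by
  refine mul_left_cancel₀ (zpow_ne_zero (a ^ 2) hs) ?_
  rw [refinedS_eq_kap hs, ← neg_sq, refinedS_eq_kap hs, kap, tripleConv_swap, neg_neg, kap]
  congr 2 <;> ring

theorem sum_gauss_mul_refinedT_mul_eq_refinedS (hs : s ≠ 0) (hp : Generic (s ^ 2)) (c : ℕ)
    (j L : ℤ) (M : ℕ) :
    ∑ i ∈ Finset.range (M + 1), gauss (s ^ 2) L (M - i) *
        (s ^ ((i : ℤ) ^ 2) * refinedT s i (L - i) ((c + 1) * j) j) =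
      s ^ (((c + 1) * j) ^ 2) * refinedS L M ((c + 2) * j) ((c + 1) * j) (s ^ 2) := by
  have hpos : ∀ j : ℤ, 0 ≤ j → j ≤ (c + 1) * j := fun j hj => by nlinarith
  rcases le_total 0 j with hj | hj
  · rw [sum_gauss_mul_refinedT_eq_refinedS hs hp (hpos j hj) hj]
    congr 2; ring
  · have h := sum_gauss_mul_refinedT_eq_refinedS hs hp (hpos (-j) (by omega)) (by omega) L M
    rw [show ((c : ℤ) + 1) * -j + -j = -((c + 2) * j) by ring, mul_neg] at h
    simpa only [refinedT_neg_neg, refinedS_neg_neg hs, neg_sq] using h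

/-! ### Tuples -/

theorem sum_Icc_one_succ {M : Type*} [AddCommMonoid M] (ν : ℕ) (g : ℕ → M) :
    ∑ k ∈ Finset.Icc 1 (ν + 1), g k = g 1 + ∑ k ∈ Finset.Icc 1 ν, g (k + 1) := by
  induction ν with
  | zero => simp
  | succ ν ih =>
    rw [Finset.sum_Icc_succ_top (by omega), ih, Finset.sum_Icc_succ_top (by omega), add_assoc]

theorem prod_Icc_one_succ {M : Type*} [CommMonoid M] (ν : ℕ) (g : ℕ → M) :
    ∏ k ∈ Finset.Icc 1 (ν + 1), g k = g 1 * ∏ k ∈ Finset.Icc 1 ν, g (k + 1) := by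
  induction ν with
  | zero => simp
  | succ ν ih =>
    rw [Finset.prod_Icc_succ_top (by omega), ih, Finset.prod_Icc_succ_top (by omega), mul_assoc]

theorem entry_one {ν : ℕ} (n : Fin (ν + 1) → ℕ) : entry n 1 = n 0 := by
  rw [entry, dif_pos (by omega)]
  rfl

theorem entry_add_one {ν : ℕ} (n : Fin (ν + 1) → ℕ) {k : ℕ} (hk : 1 ≤ k) :
    entry n (k + 1) = entry (Fin.tail n) k := by
  unfold entry
  by_cases h : k ≤ ν
  · rw [dif_pos (by omega), dif_pos (by omega), Fin.tail]
    congr 1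
    ext
    simp only [Fin.val_succ]
    omega
  · rw [dif_neg (by omega), dif_neg (by omega)]

theorem tail_add_one {ν : ℕ} (n : Fin (ν + 1) → ℕ) {k : ℕ} (hk : 1 ≤ k) :
    tail n (k + 1) = tail (Fin.tail n) k := by
  unfold tail
  rw [← Finset.sum_map (Finset.Icc k ν) (addRightEmbedding 1) (entry n) |>.trans
    (Finset.sum_congr rfl fun l hl => ?_), Finset.map_add_right_Icc]
  exact entry_add_one n (hk.trans (Finset.mem_Icc.1 hl).1)

theorem tail_one {ν : ℕ} (n : Fin ν → ℕ) : tail n 1 = ∑ i, n i := by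
  induction ν with
  | zero => simp [tail]
  | succ ν ih =>
    rw [tail, sum_Icc_one_succ, Fin.sum_univ_succ, entry_one]
    congr 1
    rw [← Fin.tail_def (q := n), ← ih, tail]
    exact Finset.sum_congr rfl fun l hl => entry_add_one n (Finset.mem_Icc.1 hl).1

theorem sum_tail {ν : ℕ} {A : Type*} [AddCommMonoid A] (n : Fin (ν + 1) → ℕ) (g : ℕ → A) :
    ∑ k ∈ Finset.Icc 1 (ν + 1), g (tail n k) =
      g (tail n 1) + ∑ k ∈ Finset.Icc 1 ν, g (tail (Fin.tail n) k) := by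
  rw [sum_Icc_one_succ]
  congr 1
  exact Finset.sum_congr rfl fun l hl => by rw [tail_add_one n (Finset.mem_Icc.1 hl).1]

/-! ### The multisum -/

/-- The term of the multisum for fixed `i`, as produced by the iteration: the index `M` is the
previous `N_k`, and `k` is `i` minus the sum of the previous `N_k`. -/
def iterTerm (r : ℂ) : (ν : ℕ) → ℤ → ℕ → ℕ × (Fin ν → ℕ) → ℂ
  | 0, k, M, x => seedTerm r k M x.1
  | ν + 1, k, M, x =>
    gauss ((r ^ 3) ^ 2) k (M - (∑ i, x.2 i : ℕ)) * ((r ^ 3) ^ (((∑ i, x.2 i : ℕ) : ℤ) ^ 2) *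
      iterTerm r ν (k - (∑ i, x.2 i : ℕ)) (∑ i, x.2 i) (x.1, Fin.tail x.2))

theorem seedTerm_of_lt {k : ℤ} {n m : ℕ} (h : 3 * n < m) : seedTerm r k n m = 0 := by
  rw [seedTerm, ebin_of_lt r (by omega), zero_mul, ite_self]

theorem iterTerm_of_lt {ν : ℕ} {M : ℕ} {x : ℕ × (Fin ν → ℕ)} (h : M < ∑ i, x.2 i) (k : ℤ) :
    iterTerm r ν k M x = 0 := by
  cases ν with
  | zero => simp at h
  | succ ν => rw [iterTerm, gauss_of_right_neg _ (by omega), zero_mul]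

theorem finsum_iterTerm (hr : r ≠ 0) (hq : Generic (r ^ 2)) (hp : Generic ((r ^ 3) ^ 2)) (ν : ℕ) :
    ∀ (k : ℤ) (M : ℕ), (Function.support (iterTerm r ν k M)).Finite ∧
      ∑ᶠ x, iterTerm r ν k M x = iterSum r ν k M := by
  induction ν with
  | zero =>
    intro k M
    have hs : (Function.support (seedTerm r k M)).Finite := by
      refine (Set.finite_Iic (3 * M)).subset fun m hm => ?_
      by_contra h
      exact hm (seedTerm_of_lt (not_le.1 h))
    constructor
    · exact hs.preimage (Equiv.prodUnique ℕ (Fin 0 → ℕ)).injective.injOn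
    · refine (finsum_comp_equiv (Equiv.prodUnique ℕ (Fin 0 → ℕ)) (f := seedTerm r k M)).trans ?_
      rw [finsum_seedTerm hr hq hp, iterSum]
      simp
  | succ ν ih =>
    intro k M
    set φ : ℕ × (Fin (ν + 1) → ℕ) → ℕ × (ℕ × (Fin ν → ℕ)) :=
      fun x => (∑ i, x.2 i, (x.1, Fin.tail x.2)) with hφ
    have hφi : Function.Injective φ := by
      rintro ⟨m, n⟩ ⟨m', n'⟩ h
      simp only [hφ, Prod.mk.injEq, Fin.sum_univ_succ] at h
      obtain ⟨h1, h2, h3⟩ := h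
      have h4 : ∀ i : Fin ν, n i.succ = n' i.succ := fun i => congrFun h3 i
      simp only [h4, add_left_inj] at h1
      refine Prod.ext h2 (funext fun i => ?_)
      exact Fin.cases h1 h4 i
    set G : ℕ × (ℕ × (Fin ν → ℕ)) → ℂ := fun y => gauss ((r ^ 3) ^ 2) k (M - (y.1 : ℕ)) *
      ((r ^ 3) ^ ((y.1 : ℤ) ^ 2) * iterTerm r ν (k - (y.1 : ℕ)) y.1 y.2) with hG
    have hGφ : iterTerm r (ν + 1) k M = G ∘ φ := rfl
    have hG0 : ∀ N : ℕ, M < N → ∀ y, G (N, y) = 0 := fun N hN y => by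
      simp only [hG]
      rw [gauss_of_right_neg _ (by omega), zero_mul]
    have hGf : (Function.support G).Finite := by
      refine ((Set.finite_Iic M).biUnion fun N _ =>
        ((ih (k - N) N).1.image (Prod.mk N))).subset ?_
      rintro ⟨N, y⟩ hy
      rw [Set.mem_iUnion₂]
      refine ⟨N, ?_, y, ?_, rfl⟩
      · by_contra h
        exact hy (hG0 N (not_le.1 h) y)
      · intro h
        exact hy (by simp only [hG, h, mul_zero])
    constructor
    · exact hGf.preimage hφi.injOn
    · have h1 : ∑ᶠ x, iterTerm r (ν + 1) k M x = ∑ᶠ y, G y := by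
        rw [hGφ]
        refine (finsum_eq_finsum_comp hφi ?_).symm
        rintro ⟨N, m, n⟩ hy
        -- A point is outside the range of `φ` only if N_1 < N_2, since otherwise n_1 = N_1 - N_2
        -- gives a preimage.
        have hlt : N < ∑ i, n i := by
          by_contra h
          refine hy ⟨(m, Fin.cons (N - ∑ i, n i) n), ?_⟩
          simp only [hφ, Fin.tail_cons, Fin.sum_univ_succ, Fin.cons_zero, Fin.cons_succ]
          rw [Nat.sub_add_cancel (not_lt.1 h)]
        simp only [hG]
        rw [iterTerm_of_lt hlt, mul_zero, mul_zero]
      rw [h1, finsum_curry _ hGf, finsum_eq_sum_of_support_subset _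
        (s := Finset.range (M + 1)), ← iterSum_succ hr hp]
      · refine Finset.sum_congr rfl fun N _ => ?_
        simp only [hG]
        rw [← mul_finsum, ← mul_finsum, (ih (k - N) N).2]
      · intro N hN
        rw [Finset.coe_range, Set.mem_Iio]
        by_contra h
        refine hN ?_
        simp only [hG0 N (by omega), finsum_zero]

/-- The closed form of `iterTerm`. -/
theorem iterTerm_eq (ν : ℕ) : ∀ (k : ℤ) (M m : ℕ) (n : Fin (ν + 1) → ℕ),
    iterTerm r (ν + 1) k M (m, n) =
      r ^ (3 * ∑ l ∈ Finset.Icc 1 (ν + 1), tail n l ^ 2) *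
        gauss ((r ^ 3) ^ 2) k (M - tail n 1) *
        seedTerm r (k - ∑ l ∈ Finset.Icc 1 (ν + 1), (tail n l : ℤ)) (entry n (ν + 1)) m *
        ∏ j ∈ Finset.Icc 1 ν,
          gauss ((r ^ 3) ^ 2) (k - ∑ l ∈ Finset.Icc 1 j, (tail n l : ℤ)) (entry n j) := by
  induction ν with
  | zero =>
    intro k M m n
    have h : ((r ^ 3) ^ (((tail n 1 : ℕ) : ℤ) ^ 2) : ℂ) = r ^ (3 * tail n 1 ^ 2) := by
      rw [pow_mul]; norm_cast
    have h2 : entry n (0 + 1) = tail n 1 := by simp [tail]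
    simp only [iterTerm]
    rw [← tail_one, h, h2]
    simp
    ring
  | succ ν ih =>
    intro k M m n
    have h : ((r ^ 3) ^ (((tail n 1 : ℕ) : ℤ) ^ 2) : ℂ) = r ^ (3 * tail n 1 ^ 2) := by
      rw [pow_mul]; norm_cast
    rw [iterTerm]
    simp only
    rw [← tail_one, ih, h, sum_tail n (fun x => x ^ 2), sum_tail n (fun x => (x : ℤ)),
      prod_Icc_one_succ, entry_add_one n (by omega : 1 ≤ ν + 1), mul_add, pow_add, entry_one,
      Finset.Icc_self, Finset.sum_singleton, sub_sub]
    have h1 : (tail n 1 : ℤ) - tail (Fin.tail n) 1 = n 0 := by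
      rw [tail_one, tail_one, Fin.sum_univ_succ]
      simp [Fin.tail]
    have h2 : ∀ j ∈ Finset.Icc 1 ν, gauss ((r ^ 3) ^ 2)
        (k - tail n 1 - ∑ l ∈ Finset.Icc 1 j, (tail (Fin.tail n) l : ℤ)) (entry (Fin.tail n) j) =
        gauss ((r ^ 3) ^ 2) (k - ∑ l ∈ Finset.Icc 1 (j + 1), (tail n l : ℤ))
          (entry n (j + 1)) := fun j hj => by
      have hj1 := (Finset.mem_Icc.1 hj).1
      rw [entry_add_one n hj1, sum_Icc_one_succ, sub_sub]
      congr 3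
      exact Finset.sum_congr rfl fun l hl => by rw [tail_add_one n (Finset.mem_Icc.1 hl).1]
    rw [Finset.prod_congr rfl h2, h1]
    ring

theorem multisumTerm_support_subset (ν L M : ℕ) (hν : 1 ≤ ν) (q : ℂ) :
    Function.support (multisumTerm ν L M q) ⊆
      Set.Iic L ×ˢ (Set.Iic (3 * L) ×ˢ Set.Iic fun _ => L) := by
  rintro ⟨i, m, n⟩ hx
  have h1 : i + tail n 1 ≤ L := by
    by_contra h
    refine hx ?_
    simp only [multisumTerm]
    rw [qBinom_of_lt (N := (L : ℤ) - tail n 1) (n := i) _ (by omega)]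
    simp
  have h2 : m ≤ 3 * entry n ν := by
    by_contra h
    refine hx ?_
    simp only [multisumTerm]
    rw [qBinom_of_lt (N := 3 * (entry n ν : ℤ)) (n := m) _ (by omega)]
    simp
  have h3 : entry n ν ≤ tail n 1 :=
    Finset.single_le_sum (f := entry n) (fun _ _ => Nat.zero_le _) (Finset.mem_Icc.2 ⟨hν, le_rfl⟩)
  have h4 : ∀ l, n l ≤ tail n 1 := fun l => by
    rw [tail_one]
    exact Finset.single_le_sum (f := n) (fun _ _ => Nat.zero_le _) (Finset.mem_univ l)
  refine ⟨?_, ?_, fun l => ?_⟩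
  · simp only [Set.mem_Iic]; omega
  · simp only [Set.mem_Iic]; omega
  · exact (h4 l).trans (show tail n 1 ≤ L by omega)

theorem multisumTerm_support_finite (ν L M : ℕ) (hν : 1 ≤ ν) (q : ℂ) :
    (Function.support (multisumTerm ν L M q)).Finite :=
  ((Set.finite_Iic _).prod ((Set.finite_Iic _).prod (Set.finite_Iic _))).subset
    (multisumTerm_support_subset ν L M hν q)

theorem multisumTerm_of_lt {ν L M i : ℕ} (h : L < i) (hν : 1 ≤ ν) (q : ℂ)
    (y : ℕ × (Fin ν → ℕ)) : multisumTerm ν L M q (i, y) = 0 := by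
  by_contra h'
  have := (multisumTerm_support_subset ν L M hν q h').1
  simp only [Set.mem_Iic] at this
  omega

theorem multisumTerm_eq_iterTerm {ν L M i : ℕ} (hν : 1 ≤ ν) (hi : i ≤ L)
    (y : ℕ × (Fin ν → ℕ)) :
    multisumTerm ν L M (r ^ 2) (i, y) =
      gauss ((r ^ 3) ^ 2) L (M - i) * ((r ^ 3) ^ ((i : ℤ) ^ 2) *
        iterTerm r ν i (L - i) y) := by
  obtain ⟨ν, rfl⟩ : ∃ t, ν = t + 1 := ⟨ν - 1, by omega⟩
  obtain ⟨m, n⟩ := y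
  have hp : (r ^ 2) ^ 3 = (r ^ 3) ^ 2 := by ring
  rw [iterTerm_eq]
  simp only [multisumTerm, seedTerm, hp]
  have hpar : i + m ≡ ∑ k ∈ Finset.Icc 1 (ν + 1), tail n k [MOD 2] ↔
      Even ((i : ℤ) - ∑ l ∈ Finset.Icc 1 (ν + 1), (tail n l : ℤ) - m) := by
    rw [← Nat.cast_sum, Nat.ModEq, Int.even_iff]
    omega
  by_cases h : i + m ≡ ∑ k ∈ Finset.Icc 1 (ν + 1), tail n k [MOD 2]
  · rw [if_pos h, if_pos (hpar.1 h), ebin]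
    have e1 : gauss ((r ^ 3) ^ 2) L (M - i) = qBinom ((r ^ 3) ^ 2) ((L : ℤ) + M - i) L := by
      rw [gauss, qBinom_symm]; congr 1 <;> ring
    have e2 : gauss ((r ^ 3) ^ 2) i (((L - i : ℕ) : ℤ) - tail n 1) =
        qBinom ((r ^ 3) ^ 2) ((L : ℤ) - tail n 1) i := by
      rw [gauss, qBinom_symm, Nat.cast_sub hi]; congr 1 <;> ring
    -- Squares keep parity, so the congruence on i + m makes the exponent even and its halving
    -- exact.
    have hev : 2 ∣ m ^ 2 + 3 * (i ^ 2 + ∑ k ∈ Finset.Icc 1 (ν + 1), tail n k ^ 2) := by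
      have hsum : ∑ k ∈ Finset.Icc 1 (ν + 1), tail n k ^ 2 ≡
          ∑ k ∈ Finset.Icc 1 (ν + 1), tail n k [MOD 2] := by
        have hsq : ∀ x : ℕ, x ^ 2 ≡ x [MOD 2] := fun x => by
          rcases Nat.even_or_odd' x with ⟨c, rfl | rfl⟩ <;> simp [Nat.ModEq, Nat.pow_mod, Nat.add_mod]
        induction Finset.Icc 1 (ν + 1) using Finset.induction_on with
        | empty => rfl
        | insert a t ha ih => rw [Finset.sum_insert ha, Finset.sum_insert ha]; exact (hsq _).add ih
      have hm : m ^ 2 % 2 = m % 2 := by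
        rcases Nat.even_or_odd' m with ⟨c, rfl | rfl⟩ <;> simp [Nat.pow_mod, Nat.add_mod]
      have hi2 : i ^ 2 % 2 = i % 2 := by
        rcases Nat.even_or_odd' i with ⟨c, rfl | rfl⟩ <;> simp [Nat.pow_mod, Nat.add_mod]
      simp only [Nat.ModEq] at hsum h
      omega
    have e3 : (r ^ 2) ^ ((m ^ 2 + 3 * (i ^ 2 + ∑ k ∈ Finset.Icc 1 (ν + 1), tail n k ^ 2)) / 2) =
        r ^ ((m : ℤ) ^ 2) * (r ^ 3) ^ ((i : ℤ) ^ 2) *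
          r ^ (3 * ∑ l ∈ Finset.Icc 1 (ν + 1), tail n l ^ 2) := by
      rw [← pow_mul, Nat.mul_div_cancel' hev]
      norm_cast
      rw [← pow_mul, ← pow_add, ← pow_add]
      congr 1; ring
    have e4 : (i : ℤ) - m - ∑ k ∈ Finset.Icc 1 (ν + 1), (tail n k : ℤ) =
        i - ∑ k ∈ Finset.Icc 1 (ν + 1), (tail n k : ℤ) - m := by ring
    rw [e1, e2, e3, e4, Nat.add_sub_cancel]
    simp only [gauss]
    ring
  · rw [if_neg h, if_neg fun h' => h (hpar.2 h')]
    ring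

theorem finsum_multisumTerm (hr : r ≠ 0) (hq : Generic (r ^ 2)) (hp : Generic ((r ^ 3) ^ 2))
    {ν : ℕ} (hν : 1 ≤ ν) (L M : ℕ) :
    ∑ᶠ x, multisumTerm ν L M (r ^ 2) x = ∑ i ∈ Finset.range (M + 1),
      gauss ((r ^ 3) ^ 2) L (M - i) * ((r ^ 3) ^ ((i : ℤ) ^ 2) *
        if i ≤ L then iterSum r ν i (L - i) else 0) := by
  have h : ∀ i : ℕ, ∑ᶠ y, multisumTerm ν L M (r ^ 2) (i, y) =
      gauss ((r ^ 3) ^ 2) L (M - i) * ((r ^ 3) ^ ((i : ℤ) ^ 2) *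
        if i ≤ L then iterSum r ν i (L - i) else 0) := fun i => by
    by_cases hi : i ≤ L
    · rw [if_pos hi, finsum_congr (multisumTerm_eq_iterTerm hν hi), ← mul_finsum, ← mul_finsum,
        (finsum_iterTerm hr hq hp ν i (L - i)).2]
    · rw [if_neg hi, finsum_congr (multisumTerm_of_lt (not_le.1 hi) hν _), finsum_zero]
      ring
  rw [finsum_curry _ (multisumTerm_support_finite ν L M hν _), finsum_congr h,
    finsum_eq_sum_of_support_subset]
  intro i hi
  rw [Finset.coe_range, Set.mem_Iio]
  by_contra h'
  have hneg : (M : ℤ) - i < 0 := by omega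
  exact hi (by simp only [gauss_of_right_neg _ hneg, zero_mul])

theorem bilateralTerm_support_subset (ν L M : ℕ) (q : ℂ) :
    Function.support (bilateralTerm ν L M q) ⊆ (Finset.Icc (-M : ℤ) M : Finset ℤ) := by
  intro j hj
  rw [Finset.coe_Icc]
  by_contra h
  have h' : (M : ℤ) < |((ν : ℤ) + 2) * j - (ν + 1) * j| := by
    rw [show ((ν : ℤ) + 2) * j - (ν + 1) * j = j by ring, ← not_le, abs_le]; exact h
  exact hj (by rw [bilateralTerm, refinedS_of_lt h', mul_zero])

theorem sum_iterSum (hr : r ≠ 0) (hp : Generic ((r ^ 3) ^ 2)) (ν L M : ℕ) :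
    ∑ i ∈ Finset.range (M + 1), gauss ((r ^ 3) ^ 2) L (M - i) * ((r ^ 3) ^ ((i : ℤ) ^ 2) *
        if i ≤ L then iterSum r ν i (L - i) else 0) = ∑ᶠ j, bilateralTerm ν L M (r ^ 2) j := by
  -- The natural number `L - i` is truncated, hence the `if`; for i > L the integer L - i is
  -- negative and 𝒯 vanishes. The range up to L + M contains all the j that occur on either side.
  have h1 : ∀ i : ℕ, (if i ≤ L then iterSum r ν i (L - i) else 0) =
      ∑ j ∈ Finset.Icc (-(L + M : ℕ) : ℤ) (L + M : ℕ), r ^ (3 * (ν + 1) * j ^ 2 + 2 * j) *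
        refinedT (r ^ 3) i (L - i) ((ν + 1) * j) j := fun i => by
    split_ifs with hi
    · rw [iterSum_eq_sum (show L - i ≤ L + M by omega), Nat.cast_sub hi]
    · refine (Finset.sum_eq_zero fun j _ => ?_).symm
      have : (L : ℤ) - i < |j| := by have := abs_nonneg j; omega
      rw [refinedT_of_lt this, mul_zero]
  simp only [h1, Finset.mul_sum]
  rw [Finset.sum_comm, finsum_eq_sum_of_support_subset _
    ((bilateralTerm_support_subset ν L M (r ^ 2)).trans (Finset.coe_subset.2
      (Finset.Icc_subset_Icc (show -((L + M : ℕ) : ℤ) ≤ -M by omega)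
        (show (M : ℤ) ≤ (L + M : ℕ) by omega))))]
  refine Finset.sum_congr rfl fun j _ => ?_
  have h2 := sum_gauss_mul_refinedT_mul_eq_refinedS (pow_ne_zero 3 hr) hp ν j L M
  have hC : (((ν + 2).choose 2 : ℕ) : ℤ) * 2 = (ν + 2) * (ν + 1) := by
    rw [Nat.choose_two_right]
    have h3 : 2 ∣ (ν + 2) * (ν + 2 - 1) := (Nat.even_mul_pred_self (ν + 2)).two_dvd
    have h4 := Nat.div_mul_cancel h3
    rw [show ν + 2 - 1 = ν + 1 by omega] at h4 ⊢
    exact_mod_cast h4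
  -- The iteration contributes 3(ν + 1)j² and the last step 3(ν + 1)²j²; together they are 3(ν +
  -- 1)(ν + 2)j².
  have z : (r ^ 2) ^ (3 * ((ν + 2).choose 2 : ℤ) * j ^ 2 + j) =
      r ^ (3 * ((ν : ℤ) + 1) * j ^ 2 + 2 * j) * (r ^ 3) ^ ((((ν : ℤ) + 1) * j) ^ 2) := by
    rw [sq_zpow_eq, ← zpow_natCast r 3, ← zpow_mul, ← zpow_add₀ hr]
    congr 1
    push_cast
    linear_combination 3 * j ^ 2 * hC
  rw [bilateralTerm, z, show (r ^ 2) ^ 3 = (r ^ 3) ^ 2 by ring,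
    mul_assoc (r ^ (3 * ((ν : ℤ) + 1) * j ^ 2 + 2 * j)), ← h2, Finset.mul_sum]
  exact Finset.sum_congr rfl fun i _ => by ring

/-! ### The case `q = 0` -/

theorem qBinom_zero_base {A m : ℤ} (h : 0 ≤ m) (h' : m ≤ A) : qBinom 0 A m = 1 := by
  have : ∀ n, qPoch 0 0 n = 1 := fun n => by simp [qPoch]
  rw [qBinom, if_pos ⟨h, by omega⟩, this, this, this]; simp

theorem finsum_multisumTerm_zero {ν : ℕ} (hν : 1 ≤ ν) (L M : ℕ) :
    ∑ᶠ x, multisumTerm ν L M 0 x = 1 := by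
  have h0 : ∀ k, entry (0 : Fin ν → ℕ) k = 0 := fun k => by
    unfold entry; split_ifs <;> rfl
  have h1 : ∀ k, tail (0 : Fin ν → ℕ) k = 0 := fun k => by simp [tail, h0]
  rw [finsum_eq_single _ (0, 0, 0)]
  · simp only [multisumTerm, h0, h1]
    simp [Nat.ModEq, qBinom_zero_base]
  · rintro ⟨i, m, n⟩ hx
    simp only [multisumTerm]
    split_ifs with h
    · rw [zero_pow, zero_mul, zero_mul, zero_mul, zero_mul, zero_mul]
      intro he
      -- The floored half being 0 only bounds the numerator by 1; parity then excludes m = 1.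
      have hlt : m ^ 2 + 3 * (i ^ 2 + ∑ k ∈ Finset.Icc 1 ν, tail n k ^ 2) < 2 := by omega
      have hi : i ^ 2 = 0 := by omega
      have hs : ∑ k ∈ Finset.Icc 1 ν, tail n k ^ 2 = 0 := by omega
      have ht : ∀ k ∈ Finset.Icc 1 ν, tail n k = 0 := fun k hk =>
        pow_eq_zero_iff two_ne_zero |>.1 (Finset.sum_eq_zero_iff.1 hs k hk)
      rw [Finset.sum_eq_zero ht] at h
      have hi0 : i = 0 := by simpa using hi
      have hm0 : m = 0 := by
        have : m < 2 := by nlinarith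
        simp only [Nat.ModEq] at h
        omega
      have hn := ht 1 (Finset.mem_Icc.2 ⟨le_rfl, hν⟩)
      rw [tail_one, Finset.sum_eq_zero_iff] at hn
      exact hx (by rw [hi0, hm0, show n = 0 from funext fun l => hn l (Finset.mem_univ l)])
    · rfl

theorem finsum_bilateralTerm_zero (ν L M : ℕ) : ∑ᶠ j, bilateralTerm ν L M 0 j = 1 := by
  rw [finsum_eq_single _ 0]
  · rw [bilateralTerm, refinedS, finsum_eq_single _ 0]
    · simp only [refinedSTerm]
      simp [qBinom_zero_base]
    · intro n hn
      have : (n : ℤ) * (n + (ν + 2) * 0) ≠ 0 := by simpa using hn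
      rw [refinedSTerm, zero_pow three_ne_zero, zero_zpow _ this]; simp
  · intro j hj
    rw [bilateralTerm, zero_zpow, zero_mul]
    intro h
    have h2 : j * (3 * (((ν + 2).choose 2 : ℤ) * j) + 1) = 0 := by linear_combination h
    rcases mul_eq_zero.1 h2 with h3 | h3
    · exact hj h3
    -- Impossible modulo 3.
    · omega

end RefinedTrinomial

end

theorem mainTheorem4 (ν : ℕ) (hν : 1 ≤ ν) (L M : ℕ) (q : ℂ) (hq : ‖q‖ < 1) :
    (Function.support (RefinedTrinomial.multisumTerm ν L M q)).Finite ∧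
    (Function.support (RefinedTrinomial.bilateralTerm ν L M q)).Finite ∧
    ∑ᶠ x : ℕ × ℕ × (Fin ν → ℕ), RefinedTrinomial.multisumTerm ν L M q x =
      ∑ᶠ j : ℤ, RefinedTrinomial.bilateralTerm ν L M q j := by
  refine ⟨RefinedTrinomial.multisumTerm_support_finite ν L M hν q, (Finset.finite_toSet _).subset
    (RefinedTrinomial.bilateralTerm_support_subset ν L M q), ?_⟩
  by_cases h0 : q = 0
  · rw [h0, RefinedTrinomial.finsum_multisumTerm_zero hν,
      RefinedTrinomial.finsum_bilateralTerm_zero]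
  · obtain ⟨r, rfl⟩ : ∃ r : ℂ, q = r ^ 2 := by
      obtain ⟨r, hr⟩ := IsAlgClosed.exists_pow_nat_eq q two_pos
      exact ⟨r, hr.symm⟩
    have hr : r ≠ 0 := fun h => h0 (by rw [h]; ring)
    have hg := RefinedTrinomial.generic_of_norm_lt_one h0 hq
    have hg' : RefinedTrinomial.Generic ((r ^ 3) ^ 2) := by
      refine RefinedTrinomial.generic_of_norm_lt_one (pow_ne_zero 2 (pow_ne_zero 3 hr)) ?_
      rw [show (r ^ 3) ^ 2 = (r ^ 2) ^ 3 by ring, norm_pow]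
      exact pow_lt_one₀ (norm_nonneg _) hq three_ne_zero
    rw [RefinedTrinomial.finsum_multisumTerm hr hg hg' hν, RefinedTrinomial.sum_iterSum hr hg']
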